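/- Notation. Let $\mathbb S=\bigcup_{n\ge 0}\{0,1\}^n$ be the set of situations (finite binary sequences), with empty sequence $\square$, and let $\Omega=\{0,1\}^{\mathbb N}$ be the set of paths. For $\omega\in\Omega$, let $\omega_{1:n}\in\mathbb S$ consist of its first $n$ outcomes; for $A\subseteq\mathbb S$, let $[\![A]\!]$ be the set of all paths $\omega$ with $\omega_{1:n}\in A$ for some $n\ge 0$. A forecasting system $\varphi$ assigns to every $s\in\mathbb S$ a non-empty closed interval $\varphi(s)=[\underline\varphi(s),\overline\varphi(s)]\subseteq[0,1]$. It is *non-degenerate* if $\underline\varphi(s)<1$ and $\overline\varphi(s)>0$ for all $s\in\mathbb S$. For $f\colon\{0,1\}\to\mathbb R$, put $\overline E_{\varphi(s)}(f)=\max_{p\in\varphi(s)}[p f(1)+(1-p)f(0)]$. A map $M\colon\mathbb S\to\mathbb R$ is a *supermartingale* for $\varphi$ if $\overline E_{\varphi(s)}(M(s\,\cdot)-M(s))\le 0$ for all $s\in\mathbb S$; it is a *test supermartingale* if moreover $M\ge 0$ and $M(\square)=1$. For $G\subseteq\Omega$, the upper probability $\overline P^{\varphi}(G)$ is the infimum of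 $M(\square)$ over all supermartingales $M$ for $\varphi$ such that $\liminf_{n\to\infty}M(\omega_{1:n})\ge \mathbb I_G(\omega)$ for all $\omega\in\Omega$, where $\mathbb I_G$ is the indicator of $G$. A map $r\colon\mathbb S\to\mathbb R$ is *lower semicomputable* if there is a recursive map $q\colon\mathbb S\times\mathbb N_0\to\mathbb Q$ with $q(s,n)\le q(s,n+1)$ and $\lim_{n\to\infty}q(s,n)=r(s)$ for all $s\in\mathbb S$ and $n\in\mathbb N_0$; it is *computable* if both $r$ and $-r$ are lower semicomputable. The forecasting system $\varphi$ is *computable* if $\underline\varphi$ and $\overline\varphi$ are. A path $\omega$ is *Martin-Löf random* for $\varphi$ if $\sup_n T(\omega_{1:n})<\infty$ for every lower semicomputable test supermartingale $T$ for $\varphi$. A *Martin-Löf test* for $\varphi$ is a sequence $(G_n)_{n\ge 0}$ of subsets of $\Omega$ for which there is a recursively enumerable $A\subseteq\mathbb N_0\times\mathbb S$ such that $G_n=[\![\{s:(n,s)\in A\}]\!]$ and $\overline P^{\varphi}(G_n)\le 2^{-n}$ for all $n\ge 0$. A path $\omega$ is *Martin-Löf test random* for $\varphi$ if $\omega\notin\bigcap_{n\ge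 0}G_n$ for every Martin-Löf test $(G_n)_{n\ge 0}$ for $\varphi$. Corollary. Let $\varphi$ be a non-degenerate computable forecasting system. Then there is a (so-called universal) lower semicomputable test supermartingale $T$ for $\varphi$ such that, for every path $\omega\in\Omega$, the following two equivalences hold: $\omega$ is not Martin-Löf random for $\varphi$ if and only if $\lim_{n\to\infty}T(\omega_{1:n})=\infty$; and $\omega$ is not Martin-Löf test random for $\varphi$ if and only if $\lim_{n\to\infty}T(\omega_{1:n})=\infty$. -/

import Mathlib

open Set Filter Topology

namespace ImpreciseRandomness

/-! ### Situations, paths and forecasting systems -/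

/-- Situations: finite outcome sequences; `true` stands for the outcome `1`, `false` for `0`. -/
abbrev Situation := List Bool

/-- Paths: infinite outcome sequences; the first outcome of `ω` is `ω 0`. -/
abbrev OutcomePath := ℕ → Bool

/-- The initial segment of `ω` that consists of its first `n` outcomes. -/
def OutcomePath.upTo (ω : OutcomePath) (n : ℕ) : Situation := List.ofFn fun i : Fin n => ω i

/-- The cylinder set of all paths that go through `s`. -/
def cylinder (s : Situation) : Set OutcomePath := {ω | ∃ n, ω.upTo n = s}

/-- The set of all paths that go through some situation in `S`. -/
def cylinderUnion (S : Set Situation) : Set OutcomePath := ⋃ s ∈ S, cylinder s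

/-- Interval forecasts: non-empty closed subintervals `[I.fst, I.snd]` of the real unit interval. -/
abbrev IntervalForecast := NonemptyInterval unitInterval

/-- Forecasting systems: an interval forecast in every situation. -/
abbrev ForecastingSystem := Situation → IntervalForecast

/-- The lower forecast `min φ(s)`. -/
def ForecastingSystem.lower (φ : ForecastingSystem) (s : Situation) : ℝ := (φ s).fst

/-- The upper forecast `max φ(s)`. -/
def ForecastingSystem.upper (φ : ForecastingSystem) (s : Situation) : ℝ := (φ s).snd

/-- No forecast is the precise forecast `0` or the precise forecast `1`. -/
def ForecastingSystem.NonDegenerate (φ : ForecastingSystem) : Prop :=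
  ∀ s, φ.lower s < 1 ∧ 0 < φ.upper s

/-! ### Local expectations and supermartingales -/

/-- The expectation of the gamble `f` on a single outcome, for the precise forecast `p`. -/
def expect (p : unitInterval) (f : Bool → ℝ) : ℝ := p * f true + (1 - p) * f false

/-- The upper expectation of `f` for the interval forecast `I`: the maximum of the expectations
`expect p f` over all `p` in `I`. -/
noncomputable def upperExpect (I : IntervalForecast) (f : Bool → ℝ) : ℝ :=
  sSup ((fun p => expect p f) '' {p : unitInterval | p ∈ I})

/-- The supremum in `upperExpect` is a maximum. -/
theorem isGreatest_upperExpect (I : IntervalForecast) (f : Bool → ℝ) :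
    IsGreatest ((fun p => expect p f) '' {p : unitInterval | p ∈ I}) (upperExpect I f) := by
  have hset : {p : unitInterval | p ∈ I} = Icc I.fst I.snd := by
    ext p
    exact NonemptyInterval.mem_def
  unfold upperExpect
  rw [hset]
  refine (isCompact_Icc.image ?_).isGreatest_sSup ((nonempty_Icc.2 I.fst_le_snd).image _)
  unfold expect
  fun_prop

/-- `M` is a supermartingale for `φ`: in every situation its increment has non-positive upper
expectation. -/
def IsSupermartingale (φ : ForecastingSystem) (M : Situation → ℝ) : Prop :=
  ∀ s, upperExpect (φ s) (fun x => M (s ++ [x]) - M s) ≤ 0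

/-- Test supermartingales: non-negative, with initial value `1`. -/
def IsTestSupermartingale (φ : ForecastingSystem) (T : Situation → ℝ) : Prop :=
  IsSupermartingale φ T ∧ (∀ s, 0 ≤ T s) ∧ T [] = 1

/-! ### Global upper expectations -/

/-- The upper expectation, conditional on the situation `s`, of a bounded function `g` of the path:
the infimum of `M s` over the supermartingales `M` with `liminf M ≥ g` on all paths through `s`.
Supermartingales need not be bounded, so the limit inferior is taken in the extended reals. -/
noncomputable def globalUpperExpect (φ : ForecastingSystem) (g : OutcomePath → ℝ) (s : Situation) : ℝ :=
  sInf {a | ∃ M : Situation → ℝ, IsSupermartingale φ M ∧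
    (∀ ω ∈ cylinder s, (g ω : EReal) ≤ liminf (fun n => (M (ω.upTo n) : EReal)) atTop) ∧ a = M s}

/-- The (unconditional) upper probability of a set of paths. -/
noncomputable def upperProb (φ : ForecastingSystem) (G : Set OutcomePath) : ℝ :=
  globalUpperExpect φ (G.indicator fun _ => 1) []

/-! ### Computability -/

/-- Recursive rational maps, with a rational number coded by its numerator and denominator in lowest
terms. -/
def RecursiveRat {D : Type*} [Primcodable D] (q : D → ℚ) : Prop :=
  Computable fun d => ((q d).num, (q d).den)

/-- Lower semicomputable real maps: limits of non-decreasing recursive sequences of rational maps. -/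
def LowerSemicomputable {D : Type*} [Primcodable D] (r : D → ℝ) : Prop :=
  ∃ q : D × ℕ → ℚ, RecursiveRat q ∧ (∀ d n, q (d, n) ≤ q (d, n + 1)) ∧
    ∀ d, Tendsto (fun n => (q (d, n) : ℝ)) atTop (𝓝 (r d))

/-- Upper semicomputable real maps. -/
def UpperSemicomputable {D : Type*} [Primcodable D] (r : D → ℝ) : Prop :=
  LowerSemicomputable fun d => -r d

/-- Computable real maps. -/
def ComputableReal {D : Type*} [Primcodable D] (r : D → ℝ) : Prop :=
  LowerSemicomputable r ∧ UpperSemicomputable r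

/-- Computable forecasting systems. -/
def ForecastingSystem.IsComputable (φ : ForecastingSystem) : Prop :=
  ComputableReal φ.lower ∧ ComputableReal φ.upper

/-! ### Randomness -/

/-- `ω` is Martin-Löf random for `φ`: every lower semicomputable test supermartingale for `φ` is
bounded above on `ω`. -/
def IsMartinLofRandom (φ : ForecastingSystem) (ω : OutcomePath) : Prop :=
  ∀ T : Situation → ℝ, IsTestSupermartingale φ T → LowerSemicomputable T →
    ∃ B : ℝ, ∀ n, T (ω.upTo n) ≤ B

/-- Martin-Löf tests for `φ`: sequences of sets of paths, generated by a recursively enumerable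
subset `A` of `ℕ × Situation`, whose `n`-th member has upper probability at most `2⁻ⁿ`. -/
def IsMartinLofTest (φ : ForecastingSystem) (G : ℕ → Set OutcomePath) : Prop :=
  ∃ A : Set (ℕ × Situation), REPred (fun a => a ∈ A) ∧
    ∀ n, G n = cylinderUnion {s | (n, s) ∈ A} ∧ upperProb φ (G n) ≤ (1 / 2 : ℝ) ^ n

/-- `ω` is Martin-Löf test random for `φ`. -/
def IsMartinLofTestRandom (φ : ForecastingSystem) (ω : OutcomePath) : Prop :=
  ∀ G : ℕ → Set OutcomePath, IsMartinLofTest φ G → ω ∉ ⋂ m, G m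

end ImpreciseRandomness

open ImpreciseRandomness

/-! ### Rational numbers as a type for computations -/

/-! The implications are closed into a cycle. If the constructed `T` tends to infinity on a path,
`T` itself refutes Martin-Löf randomness. If some lower semicomputable test supermartingale is
unbounded on the path, its level sets above `2 ^ n` form a Martin-Löf test, by Ville's inequality
(`IsTestSupermartingale.upperProb_le`). What remains is a single `T` that tends to infinity on every
path captured by some Martin-Löf test.

Whether a program generates a Martin-Löf test is not visible from the program, so all programs are
used, after trimming. An index `i` codes a program together with a free number, and level `i + 2` of
what the program accepts is enumerated in finite stages. Backward recursion on a finite tree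
(`backward`) gives the conditional upper probabilities of a stage. Run with rational intervals that
enclose the forecasts, it bounds them from above; a stage is accepted once this bound at the root is
below `(1 / 2) ^ (i + 1)`. Run with intervals approximated from inside on the last accepted stage,
it gives rationals that increase to the `i`-th `summand`. Each summand satisfies the supermartingale
relation with equality, and non-degeneracy bounds it by `C s * (1 / 2) ^ (i + 1)`, so the summands
add up to a lower semicomputable supermartingale with value at most `1` at the root.

For a genuine test with program `c`, every stage of every index `Nat.pair (encode c) m` is
eventually accepted (`eventually_isAccepted`). On a captured path each of these infinitely many
summands is eventually at least `1` (`one_le_summand`), hence the sum diverges. -/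

theorem Int.encode_ofNat (n : ℕ) : Encodable.encode (n : ℤ) = 2 * n := rfl

theorem Int.encode_negSucc (n : ℕ) : Encodable.encode (Int.negSucc n) = 2 * n + 1 := rfl

/-- The lowest bit of the code of an integer is its sign, and the remaining bits give the absolute
value, shifted by one for negative integers. -/
theorem Primrec.int_toNat : Primrec Int.toNat := by
  refine (Primrec.ite (c := fun z : ℤ => (Encodable.encode z).bodd = false)
    (Primrec.eq.comp (Primrec.nat_bodd.comp .encode) (.const _))
    (Primrec.nat_div2.comp .encode) (.const 0)).of_eq fun z => ?_
  obtain n | n := z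
  · simp [Int.encode_ofNat, Nat.div2_val]
  · simp [Int.encode_negSucc]

theorem Primrec.int_toNat_neg : Primrec fun z : ℤ => (-z).toNat := by
  refine (Primrec.ite (c := fun z : ℤ => (Encodable.encode z).bodd = false)
    (Primrec.eq.comp (Primrec.nat_bodd.comp .encode) (.const _))
    (.const 0) (Primrec.succ.comp (Primrec.nat_div2.comp .encode))).of_eq fun z => ?_
  obtain n | n := z
  · simp [Int.encode_ofNat]
  · simp [Int.encode_negSucc, Nat.div2_val, Int.neg_negSucc]

theorem Primrec.int_natAbs : Primrec Int.natAbs :=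
  (Primrec.nat_add.comp Primrec.int_toNat Primrec.int_toNat_neg).of_eq fun z => by omega

theorem PrimrecRel.nat_dvd : PrimrecRel fun m n : ℕ => m ∣ n :=
  PrimrecPred.of_eq (Primrec.eq.comp (Primrec.nat_mod.comp .snd .fst) (.const 0)) fun _ =>
    (Nat.dvd_iff_mod_eq_zero ..).symm

theorem PrimrecRel.nat_coprime : PrimrecRel Nat.Coprime := by
  classical
  have h : PrimrecRel fun (m : ℕ) (p : ℕ × ℕ) => m ∣ p.1 → m ∣ p.2 → m = 1 := by
    have h₁ : PrimrecPred fun q : ℕ × ℕ × ℕ => q.1 ∣ q.2.1 :=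
      PrimrecRel.nat_dvd.comp .fst (.comp .fst .snd)
    have h₂ : PrimrecPred fun q : ℕ × ℕ × ℕ => q.1 ∣ q.2.2 :=
      PrimrecRel.nat_dvd.comp .fst (.comp .snd .snd)
    have h₃ : PrimrecPred fun q : ℕ × ℕ × ℕ => q.1 = 1 := Primrec.eq.comp .fst (.const 1)
    exact (h₁.not.or (h₂.not.or h₃)).of_eq fun q => by tauto
  -- Coprimality needs only a bounded search: the range up to `a + b` contains the gcd, even when
  -- one of the numbers is zero.
  have h' := (h.forall_mem_list).comp (f := fun p : ℕ × ℕ => List.range (p.1 + p.2 + 1))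
    (g := id) (Primrec.list_range.comp (Primrec.succ.comp Primrec.nat_add)) .id
  refine h'.of_eq fun ⟨a, b⟩ => ⟨fun H => ?_, fun H m _ h₁ h₂ => ?_⟩
  · refine H (Nat.gcd a b) ?_ (Nat.gcd_dvd_left a b) (Nat.gcd_dvd_right a b)
    rw [List.mem_range]
    dsimp only
    rcases Nat.eq_zero_or_pos a with rfl | ha
    · simp
    · have := Nat.gcd_le_left b ha
      omega
  · exact Nat.dvd_one.1 (H ▸ Nat.dvd_gcd h₁ h₂)

/-- The pairs of a numerator and a denominator in lowest terms. -/
abbrev IsReducedFraction (p : ℤ × ℕ) : Prop := p.2 ≠ 0 ∧ p.1.natAbs.Coprime p.2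

theorem primrecPred_isReducedFraction : PrimrecPred IsReducedFraction :=
  PrimrecPred.and (PrimrecPred.not (Primrec.eq.comp .snd (.const 0)))
    (PrimrecRel.nat_coprime.comp (Primrec.int_natAbs.comp .fst) .snd)

/-- Rational numbers correspond to fractions in lowest terms. -/
def Rat.equivReducedFraction : ℚ ≃ {p : ℤ × ℕ // IsReducedFraction p} where
  toFun q := ⟨(q.num, q.den), q.den_nz, q.reduced⟩
  invFun p := ⟨p.1.1, p.1.2, p.2.1, p.2.2⟩
  left_inv _ := rfl
  right_inv _ := rfl

/-- The effective coding of the rational numbers by fractions in lowest terms. -/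
@[reducible]
def Rat.primcodable : Primcodable ℚ :=
  haveI := Primcodable.subtype primrecPred_isReducedFraction
  Primcodable.ofEquiv _ Rat.equivReducedFraction

attribute [local instance] Rat.primcodable

namespace Computable

variable {α β : Type*} [Primcodable α] [Primcodable β]

/-- The bridge to `RecursiveRat`, which mentions only numerators and denominators. -/
theorem rat_iff {f : α → ℚ} : Computable f ↔ Computable fun a => ((f a).num, (f a).den) := by
  let := Primcodable.subtype primrecPred_isReducedFraction
  have h : Primrec fun q : ℚ => (q.num, q.den) :=
    (Primrec.subtype_val (hp := primrecPred_isReducedFraction)).comp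
      (Primrec.of_equiv (e := Rat.equivReducedFraction))
  refine ⟨fun hf => h.to_comp.comp hf, fun hf => ?_⟩
  have h₁ : Computable fun a => Rat.equivReducedFraction (f a) :=
    Computable.subtype_mk (hp := primrecPred_isReducedFraction) hf
  exact ((Primrec.of_equiv_symm (e := Rat.equivReducedFraction)).to_comp.comp h₁).of_eq
    fun a => by simp

/-- A function is computable when its graph is decidable. -/
theorem of_graph {f : α → β} (h : ComputablePred fun p : α × β => f p.1 = p.2) :
    Computable f := by
  classical
  -- Unbounded search through the codes `n`, until one decodes to the value of `f` at `a`.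
  have h₁ : Computable₂ fun (a : α) (n : ℕ) =>
      (Encodable.decode (α := β) n).bind fun b => if f a = b then some b else none := by
    refine Computable.option_bind (Computable.decode.comp .snd) ?_
    have h₀ : Computable fun p : (α × ℕ) × β => (p.1.1, p.2) :=
      (Computable.fst.comp .fst).pair .snd
    have h₁ := h.decide.comp h₀
    have h₂ := Computable.cond h₁ (Computable.option_some.comp .snd) (.const none)
    exact (h₂.of_eq (g := fun p => if f p.1.1 = p.2 then some p.2 else none)
      fun p => by by_cases hp : f p.1.1 = p.2 <;> simp only [hp, decide_true, decide_false,
        cond_true, cond_false, if_true, if_false]).to₂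
  refine (Partrec.rfindOpt h₁).of_eq_tot fun a => ?_
  have hd : (Nat.rfindOpt fun n => (Encodable.decode (α := β) n).bind fun b =>
      if f a = b then some b else none).Dom := by
    rw [Nat.rfindOpt_dom]
    exact ⟨Encodable.encode (f a), f a, by simp⟩
  obtain ⟨n, hn⟩ := Nat.rfindOpt_spec (Part.get_mem hd)
  simp only [Option.mem_def, Option.bind_eq_some_iff, Option.ite_none_right_eq_some,
    Option.some.injEq] at hn
  obtain ⟨b, -, rfl, hb⟩ := hn
  have := Part.get_mem hd
  rwa [← hb] at this

theorem rat_den : Computable Rat.den := Computable.snd.comp (rat_iff.1 Computable.id)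

theorem rat_num : Computable Rat.num := Computable.fst.comp (rat_iff.1 Computable.id)

end Computable

theorem PrimrecPred.computablePred_comp {α β : Type*} [Primcodable α] [Primcodable β]
    {p : β → Prop} (hp : PrimrecPred p) {f : α → β} (hf : Computable f) :
    ComputablePred fun a => p (f a) := by
  obtain ⟨_, hp⟩ := hp
  exact ⟨fun a => inferInstance, hp.to_comp.comp hf⟩

/-- The positive and negative parts of the numerator, and the denominator. -/
def Rat.parts (q : ℚ) : ℕ × ℕ × ℕ := (q.num.toNat, (-q.num).toNat, q.den)

theorem Computable.rat_parts : Computable Rat.parts :=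
  (Primrec.int_toNat.to_comp.comp rat_num).pair
    ((Primrec.int_toNat_neg.to_comp.comp rat_num).pair rat_den)

theorem Rat.eq_parts (q : ℚ) : q = ((q.parts.1 : ℚ) - q.parts.2.1) / q.parts.2.2 := by
  have h : ((q.parts.1 : ℤ) - q.parts.2.1) = q.num := by simp [Rat.parts]
  have h' : ((q.parts.1 : ℚ) - q.parts.2.1) = q.num := by rw [← h]; push_cast; rfl
  rw [h']
  exact (Rat.num_div_den q).symm

theorem Rat.parts_den_pos (q : ℚ) : (0 : ℚ) < q.parts.2.2 := by
  exact_mod_cast q.den_pos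

theorem Rat.eq_iff_parts {a b d : ℕ} (hd : d ≠ 0) (q : ℚ) : ((a : ℚ) - b) / d = q ↔
    a * q.parts.2.2 + q.parts.2.1 * d = b * q.parts.2.2 + q.parts.1 * d := by
  have h := q.parts_den_pos
  have hd' : (d : ℚ) ≠ 0 := by exact_mod_cast hd
  conv_lhs => rw [q.eq_parts, div_eq_div_iff hd' h.ne']
  rw [← Nat.cast_inj (R := ℚ)]
  push_cast
  constructor <;> intro H <;> linarith

theorem Rat.le_iff_parts (p q : ℚ) : p ≤ q ↔
    p.parts.1 * q.parts.2.2 + q.parts.2.1 * p.parts.2.2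
      ≤ q.parts.1 * p.parts.2.2 + p.parts.2.1 * q.parts.2.2 := by
  conv_lhs => rw [p.eq_parts, q.eq_parts, div_le_div_iff₀ p.parts_den_pos q.parts_den_pos]
  rw [← Nat.cast_le (α := ℚ)]
  push_cast
  constructor <;> intro H <;> linarith

/-! ### Computable arithmetic and order on the rational numbers -/

section ratComputable

variable {α : Type*} [Primcodable α]

namespace Computable

theorem nat_add {f g : α → ℕ} (hf : Computable f) (hg : Computable g) :
    Computable fun a => f a + g a := Primrec.nat_add.to_comp.comp hf hg

theorem nat_mul {f g : α → ℕ} (hf : Computable f) (hg : Computable g) :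
    Computable fun a => f a * g a := Primrec.nat_mul.to_comp.comp hf hg

theorem ratPos {f : α → ℚ} (hf : Computable f) : Computable fun a => (f a).parts.1 :=
  Computable.fst.comp (rat_parts.comp hf)

theorem ratNeg {f : α → ℚ} (hf : Computable f) : Computable fun a => (f a).parts.2.1 :=
  Computable.fst.comp (Computable.snd.comp (rat_parts.comp hf))

theorem ratDen {f : α → ℚ} (hf : Computable f) : Computable fun a => (f a).parts.2.2 :=
  Computable.snd.comp (Computable.snd.comp (rat_parts.comp hf))

/-- The graph is decided by an equation between natural numbers, so the fraction never has to be
reduced explicitly. -/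
theorem ratMk {f g h : α → ℕ} (hf : Computable f) (hg : Computable g) (hh : Computable h)
    (h0 : ∀ a, h a ≠ 0) : Computable fun a => ((f a : ℚ) - g a) / h a := by
  refine of_graph ?_
  have hs := Computable.snd (α := α) (β := ℚ)
  exact ((Primrec.eq (α := ℕ)).computablePred_comp
    (((hf.comp .fst).nat_mul hs.ratDen).nat_add (hs.ratNeg.nat_mul (hh.comp .fst)) |>.pair
    (((hg.comp .fst).nat_mul hs.ratDen).nat_add (hs.ratPos.nat_mul (hh.comp .fst))))).of_eq
    fun p => (Rat.eq_iff_parts (h0 p.1) p.2).symm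

theorem rat_add {f g : α → ℚ} (hf : Computable f) (hg : Computable g) :
    Computable fun a => f a + g a := by
  refine (ratMk ((hf.ratPos.nat_mul hg.ratDen).nat_add (hg.ratPos.nat_mul hf.ratDen))
    ((hf.ratNeg.nat_mul hg.ratDen).nat_add (hg.ratNeg.nat_mul hf.ratDen))
    (hf.ratDen.nat_mul hg.ratDen) fun a => mul_ne_zero (f a).den_nz (g a).den_nz).of_eq fun a => ?_
  have h₁ := (f a).parts_den_pos.ne'
  have h₂ := (g a).parts_den_pos.ne'
  conv_rhs => rw [(f a).eq_parts, (g a).eq_parts]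
  push_cast
  field_simp
  ring

theorem rat_mul {f g : α → ℚ} (hf : Computable f) (hg : Computable g) :
    Computable fun a => f a * g a := by
  refine (ratMk ((hf.ratPos.nat_mul hg.ratPos).nat_add (hf.ratNeg.nat_mul hg.ratNeg))
    ((hf.ratPos.nat_mul hg.ratNeg).nat_add (hf.ratNeg.nat_mul hg.ratPos))
    (hf.ratDen.nat_mul hg.ratDen) fun a => mul_ne_zero (f a).den_nz (g a).den_nz).of_eq fun a => ?_
  have h₁ := (f a).parts_den_pos.ne'
  have h₂ := (g a).parts_den_pos.ne'
  conv_rhs => rw [(f a).eq_parts, (g a).eq_parts]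
  push_cast
  field_simp
  ring

theorem rat_neg {f : α → ℚ} (hf : Computable f) : Computable fun a => -f a :=
  ((Computable.const (-1 : ℚ)).rat_mul hf).of_eq fun _ => by ring

theorem rat_sub {f g : α → ℚ} (hf : Computable f) (hg : Computable g) :
    Computable fun a => f a - g a :=
  (hf.rat_add hg.rat_neg).of_eq fun _ => by ring

end Computable

theorem ComputablePred.rat_le {f g : α → ℚ} (hf : Computable f) (hg : Computable g) :
    ComputablePred fun a => f a ≤ g a :=
  (Primrec.nat_le.computablePred_comp
    ((hf.ratPos.nat_mul hg.ratDen).nat_add (hg.ratNeg.nat_mul hf.ratDen) |>.pair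
    ((hg.ratPos.nat_mul hf.ratDen).nat_add (hf.ratNeg.nat_mul hg.ratDen)))).of_eq
    fun a => (Rat.le_iff_parts (f a) (g a)).symm

theorem ComputablePred.rat_lt {f g : α → ℚ} (hf : Computable f) (hg : Computable g) :
    ComputablePred fun a => f a < g a :=
  (ComputablePred.rat_le hg hf).not.of_eq fun _ => not_le

namespace Computable

theorem ite_pred {β : Type*} [Primcodable β] {p : α → Prop} [DecidablePred p]
    (hp : ComputablePred p) {f g : α → β} (hf : Computable f) (hg : Computable g) :
    Computable fun a => if p a then f a else g a :=
  (hp.decide.cond hf hg).of_eq fun a => by by_cases h : p a <;> simp [h]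

theorem rat_max {f g : α → ℚ} (hf : Computable f) (hg : Computable g) :
    Computable fun a => max (f a) (g a) :=
  (ite_pred (ComputablePred.rat_le hf hg) hg hf).of_eq fun _ => (max_def _ _).symm

theorem rat_min {f g : α → ℚ} (hf : Computable f) (hg : Computable g) :
    Computable fun a => min (f a) (g a) :=
  (ite_pred (ComputablePred.rat_le hf hg) hf hg).of_eq fun _ => (min_def _ _).symm

theorem rat_pow (c : ℚ) {f : α → ℕ} (hf : Computable f) : Computable fun a => c ^ f a :=
  (Computable.nat_rec hf (.const 1) (h := fun _ p => p.2 * c)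
    ((Computable.snd.comp .snd).rat_mul (.const c)).to₂).of_eq fun a => by
      induction f a with
      | zero => simp
      | succ n ih => rw [pow_succ, ← ih]

end Computable

end ratComputable

/-! ### Recursion along the binary tree -/

namespace Computable

variable {α γ : Type*} [Primcodable α] [Primcodable γ]

/-- The recursion along the infinite binary tree, with a given depth. -/
def _root_.treeRec (base : List Bool → γ) (step : List Bool → γ → γ → γ) :
    ℕ → List Bool → γ
  | 0, s => base s
  | d + 1, s => step s (treeRec base step d (s ++ [false])) (treeRec base step d (s ++ [true]))

/-- The recursion makes two calls at changed situations. Kleene's recursion theorem handles this: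
`body` unfolds the recursion once and delegates its calls to a code `c`; a code that computes its
own `body` then terminates with the right value, by induction on the depth. -/
theorem treeRec {base : α → List Bool → γ} {step : α → List Bool → γ → γ → γ}
    (hb : Computable fun p : α × List Bool => base p.1 p.2)
    (hs : Computable fun p : α × List Bool × γ × γ => step p.1 p.2.1 p.2.2.1 p.2.2.2) :
    Computable fun p : α × ℕ × List Bool => _root_.treeRec (base p.1) (step p.1) p.2.1 p.2.2 := by
  let call : Nat.Partrec.Code → α × ℕ × List Bool →. γ := fun c p =>
    (c.eval (Encodable.encode p)).bind fun n => (Encodable.decode (α := γ) n : Part γ)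
  have hcall : Partrec₂ call :=
    (Nat.Partrec.Code.eval_part.comp .fst (Computable.encode.comp .snd)).bind
      (Computable.decode.comp .snd).ofOption.to₂
  let body : Nat.Partrec.Code → α × ℕ × List Bool →. γ := fun c p =>
    Nat.casesOn p.2.1 (Part.some (base p.1 p.2.2)) fun d =>
      (call c (p.1, d, p.2.2 ++ [false])).bind fun x =>
        (call c (p.1, d, p.2.2 ++ [true])).bind fun y => Part.some (step p.1 p.2.2 x y)
  have hsub (b : Bool) : Computable fun q : (Nat.Partrec.Code × α × ℕ × List Bool) × ℕ =>
      (q.1.2.1, q.2, q.1.2.2.2 ++ [b]) :=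
    (Computable.fst.comp (Computable.snd.comp .fst)).pair
      (Computable.snd.pair (Computable.list_concat.comp
        (Computable.snd.comp (Computable.snd.comp (Computable.snd.comp .fst))) (.const b)))
  have hbody : Partrec₂ body := by
    refine Partrec.nat_casesOn_right
      (f := fun q : Nat.Partrec.Code × α × ℕ × List Bool => q.2.2.1)
      (g := fun q => base q.2.1 q.2.2.2)
      (h := fun q d => (call q.1 (q.2.1, d, q.2.2.2 ++ [false])).bind fun x =>
        (call q.1 (q.2.1, d, q.2.2.2 ++ [true])).bind fun y =>
          Part.some (step q.2.1 q.2.2.2 x y))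
      (Computable.fst.comp (Computable.snd.comp .snd))
      (hb.comp ((Computable.fst.comp .snd).pair
        (Computable.snd.comp (Computable.snd.comp .snd)))) ?_
    refine Partrec.bind (hcall.comp (Computable.fst.comp .fst) (hsub false)) ?_
    refine Partrec.bind ((hcall.comp (Computable.fst.comp .fst) (hsub true)).comp .fst) ?_
    have h₁ : Computable fun r : (((Nat.Partrec.Code × α × ℕ × List Bool) × ℕ) × γ) × γ =>
        r.1.1.1.2 := Computable.snd.comp (Computable.fst.comp (Computable.fst.comp .fst))
    have h₂ : Computable fun r : (((Nat.Partrec.Code × α × ℕ × List Bool) × ℕ) × γ) × γ =>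
        (r.1.1.1.2.1, r.1.1.1.2.2.2, r.1.2, r.2) :=
      (Computable.fst.comp h₁).pair ((Computable.snd.comp (Computable.snd.comp h₁)).pair
        ((Computable.snd.comp .fst).pair .snd))
    have h₃ := hs.comp h₂
    exact h₃
  let f : Nat.Partrec.Code → ℕ →. ℕ := fun c n =>
    (Encodable.decode (α := α × ℕ × List Bool) n : Part _).bind fun p =>
      (body c p).map Encodable.encode
  have hf : Partrec₂ f :=
    (Computable.decode.comp .snd).ofOption.bind
      ((hbody.comp (Computable.fst.comp .fst) .snd).map (Computable.encode.comp .snd).to₂)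
  obtain ⟨c, hc⟩ := Nat.Partrec.Code.fixed_point₂ hf
  have key (a : α) (d : ℕ) : ∀ s, call c (a, d, s) = Part.some (_root_.treeRec (base a) (step a) d s) := by
    have hstep (p) : call c p = body c p := by
      simp only [call, hc, f, Encodable.encodek, Part.coe_some, Part.bind_some]
      ext x
      simp
    induction d with
    | zero => intro s; rw [hstep]; rfl
    | succ d ih =>
      intro s
      rw [hstep]
      simp only [body, ih, Part.bind_some]
      rfl
  exact (hcall.comp (.const c) .id).of_eq_tot fun p => by
    obtain ⟨a, d, s⟩ := p
    simp only [key, id]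
    exact Part.mem_some _

end Computable

namespace ImpreciseRandomness

/-! ### Local models as piecewise linear functions -/

section branch

variable {K : Type*} [Field K] [LinearOrder K]

/-- The upper expectation, for the interval forecast `[lo, up]`, of the gamble with the value `a` in
the outcome `0` and `b` in the outcome `1`. -/
def branch (lo up a b : K) : K := a + up * max (b - a) 0 - lo * max (a - b) 0

theorem branch_self (lo up a : K) : branch lo up a a = a := by simp [branch]

variable [IsStrictOrderedRing K] {lo up a b c : K}

theorem branch_of_le (h : a ≤ b) : branch lo up a b = a + up * (b - a) := by
  simp [branch, max_eq_left (sub_nonneg.2 h), max_eq_right (sub_nonpos.2 h)]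

theorem branch_of_ge (h : b ≤ a) : branch lo up a b = a + lo * (b - a) := by
  rw [branch, max_eq_left (sub_nonneg.2 h), max_eq_right (sub_nonpos.2 h)]
  ring

/-- For a genuine interval, `branch` is the maximum of two linear functionals, one for each
endpoint. -/
theorem branch_le_iff (h : lo ≤ up) :
    branch lo up a b ≤ c ↔ a + lo * (b - a) ≤ c ∧ a + up * (b - a) ≤ c := by
  rcases le_total a b with hab | hab
  · rw [branch_of_le hab]
    exact ⟨fun hc => ⟨le_trans (by gcongr) hc, hc⟩, And.right⟩
  · rw [branch_of_ge hab]
    have := mul_le_mul_of_nonpos_right h (sub_nonpos.2 hab)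
    exact ⟨fun hc => ⟨hc, by linarith⟩, And.left⟩

theorem branch_mono_forecast {lo' up' : K} (hlo : lo' ≤ lo) (hup : up ≤ up') :
    branch lo up a b ≤ branch lo' up' a b := by
  unfold branch
  gcongr

/-- `lo ≤ up` is deliberately not required: approximating both endpoints of an interval from inside
may make them cross. -/
theorem branch_mono {a' b' : K} (hlo : lo ∈ Icc 0 1) (hup : up ∈ Icc 0 1) (ha : a ≤ a')
    (hb : b ≤ b') : branch lo up a b ≤ branch lo up a' b' := by
  obtain ⟨hl₀, hl₁⟩ := hlo
  obtain ⟨hu₀, hu₁⟩ := hup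
  rcases le_total a b with h | h <;> rcases le_total a' b' with h' | h' <;>
    simp only [branch_of_le, branch_of_ge, h, h']
  · nlinarith
  · nlinarith
  · nlinarith
  · nlinarith

theorem min_le_branch (hlo : lo ∈ Icc 0 1) (hup : up ∈ Icc 0 1) : min a b ≤ branch lo up a b := by
  rw [← branch_self lo up (min a b)]
  exact branch_mono hlo hup (min_le_left a b) (min_le_right a b)

theorem mul_le_branch_right (h : lo ≤ up) (hup : up ≤ 1) (ha : 0 ≤ a) :
    up * b ≤ branch lo up a b := by
  have := ((branch_le_iff h).1 (le_refl (branch lo up a b))).2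
  nlinarith

theorem mul_le_branch_left (h : lo ≤ up) (hlo : 0 ≤ lo) (hb : 0 ≤ b) :
    (1 - lo) * a ≤ branch lo up a b := by
  have := ((branch_le_iff h).1 (le_refl (branch lo up a b))).1
  nlinarith

end branch

@[simp]
theorem cast_branch (lo up a b : ℚ) :
    ((branch lo up a b : ℚ) : ℝ) = branch (lo : ℝ) up a b := by
  simp [branch]

theorem tendsto_branch {l : Filter ℕ} {lo up a b : ℕ → ℝ} {lo' up' a' b' : ℝ}
    (hlo : Tendsto lo l (𝓝 lo')) (hup : Tendsto up l (𝓝 up')) (ha : Tendsto a l (𝓝 a'))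
    (hb : Tendsto b l (𝓝 b')) :
    Tendsto (fun n => branch (lo n) (up n) (a n) (b n)) l (𝓝 (branch lo' up' a' b')) :=
  (ha.add (hup.mul ((hb.sub ha).max tendsto_const_nhds))).sub
    (hlo.mul ((ha.sub hb).max tendsto_const_nhds))

/-! ### Backward recursion -/

/-- Induction on situations, backwards from the situations of length at least `k`. -/
theorem backward_induction {P : Situation → Prop} (k : ℕ) (h₀ : ∀ s, k ≤ s.length → P s)
    (h₁ : ∀ s, s.length < k → P (s ++ [false]) → P (s ++ [true]) → P s) (s : Situation) : P s := by
  induction h : k - s.length generalizing s with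
  | zero => exact h₀ s (by omega)
  | succ d ih => exact h₁ s (by omega) (ih _ (by simp; omega)) (ih _ (by simp; omega))

/-- Membership of `D` persists, and is decided after `k` outcomes. -/
structure IsDecidedBy (D : Situation → Bool) (k : ℕ) : Prop where
  persist : ∀ s x, D s → D (s ++ [x])
  decided : ∀ s x, k ≤ s.length → D (s ++ [x]) = D s

section backward

variable {K : Type*} [Field K] [LinearOrder K]

/-- The conditional upper probabilities of reaching `D` within the first `k` outcomes, for the
forecasts `[lo s, up s]`. -/
def backward (lo up : Situation → K) (D : Situation → Bool) (k : ℕ) (s : Situation) : K :=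
  treeRec (fun s => if D s then 1 else 0) (fun s a b => branch (lo s) (up s) a b) (k - s.length) s

variable {lo up : Situation → K} {D : Situation → Bool} {k : ℕ} {s : Situation}

theorem backward_of_le (h : k ≤ s.length) : backward lo up D k s = if D s then 1 else 0 := by
  simp [backward, Nat.sub_eq_zero_of_le h, treeRec]

theorem backward_of_lt (h : s.length < k) : backward lo up D k s =
    branch (lo s) (up s) (backward lo up D k (s ++ [false])) (backward lo up D k (s ++ [true])) := by
  obtain ⟨d, hd⟩ : ∃ d, k - s.length = d + 1 := ⟨k - s.length - 1, by omega⟩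
  have (x : Bool) : k - (s ++ [x]).length = d := by simp; omega
  simp [backward, hd, -List.length_append, this, treeRec]

/-- Beyond depth `k` the recursion persists because `D` no longer changes there. -/
theorem backward_eq (hD : IsDecidedBy D k) (s : Situation) : backward lo up D k s =
    branch (lo s) (up s) (backward lo up D k (s ++ [false])) (backward lo up D k (s ++ [true])) := by
  rcases lt_or_ge s.length k with h | h
  · exact backward_of_lt h
  · have (x : Bool) : backward lo up D k (s ++ [x]) = backward lo up D k s := by
      rw [backward_of_le h, backward_of_le (by simp; omega), hD.decided s x h]
    rw [this, this, branch_self]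

theorem backward_eq_one (hD : IsDecidedBy D k) (s : Situation) :
    D s → backward lo up D k s = 1 := by
  refine backward_induction (P := fun s => D s → backward lo up D k s = 1) k (fun s h hs => ?_)
    (fun s h h₀ h₁ hs => ?_) s
  · simp [backward_of_le h, hs]
  · rw [backward_of_lt h, h₀ (hD.persist s _ hs), h₁ (hD.persist s _ hs), branch_self]

variable [IsStrictOrderedRing K]

theorem backward_nonneg (hlo : ∀ s, lo s ∈ Icc 0 1) (hup : ∀ s, up s ∈ Icc 0 1) (s : Situation) :
    0 ≤ backward lo up D k s := by
  refine backward_induction (P := fun s => 0 ≤ backward lo up D k s) k (fun s h => ?_)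
    (fun s h h₀ h₁ => ?_) s
  · rw [backward_of_le h]
    split <;> simp
  · rw [backward_of_lt h]
    exact (le_min h₀ h₁).trans (min_le_branch (hlo s) (hup s))

/-- The induction starts at the smaller horizon `k`: there the left side is `0` or `1`, and where it
is `1` so is the right side. -/
theorem backward_mono {lo' up' : Situation → K} {D' : Situation → Bool} {k' : ℕ}
    (hlo : ∀ s, lo s ∈ Icc 0 1) (hup : ∀ s, up s ∈ Icc 0 1)
    (hlo' : ∀ s, lo' s ∈ Icc 0 1) (hup' : ∀ s, up' s ∈ Icc 0 1)
    (hll : ∀ s, lo' s ≤ lo s) (huu : ∀ s, up s ≤ up' s) (hD' : IsDecidedBy D' k')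
    (hDD : ∀ s, D s → D' s) (hkk : k ≤ k') (s : Situation) :
    backward lo up D k s ≤ backward lo' up' D' k' s := by
  refine backward_induction (P := fun s => backward lo up D k s ≤ backward lo' up' D' k' s) k
    (fun s h => ?_) (fun s h h₀ h₁ => ?_) s
  · rw [backward_of_le h]
    split
    · rw [backward_eq_one hD' s (hDD s ‹_›)]
    · exact backward_nonneg hlo' hup' s
  · rw [backward_of_lt h, backward_of_lt (h.trans_le hkk)]
    exact (branch_mono (hlo s) (hup s) h₀ h₁).trans (branch_mono_forecast (hll s) (huu s))

end backward

@[simp]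
theorem cast_backward (lo up : Situation → ℚ) (D : Situation → Bool) (k : ℕ) (s : Situation) :
    ((backward lo up D k s : ℚ) : ℝ)
      = backward (fun s => (lo s : ℝ)) (fun s => (up s : ℝ)) D k s := by
  refine backward_induction (P := fun s => ((backward lo up D k s : ℚ) : ℝ)
      = backward (fun s => (lo s : ℝ)) (fun s => (up s : ℝ)) D k s) k (fun s h => ?_)
    (fun s h h₀ h₁ => ?_) s
  · rw [backward_of_le h, backward_of_le h]
    split <;> simp
  · rw [backward_of_lt h, backward_of_lt h, cast_branch, h₀, h₁]

theorem tendsto_backward {l : Filter ℕ} {lo up : ℕ → Situation → ℝ} {lo' up' : Situation → ℝ}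
    (hlo : ∀ s, Tendsto (fun n => lo n s) l (𝓝 (lo' s)))
    (hup : ∀ s, Tendsto (fun n => up n s) l (𝓝 (up' s)))
    (D : Situation → Bool) (k : ℕ) (s : Situation) :
    Tendsto (fun n => backward (lo n) (up n) D k s) l (𝓝 (backward lo' up' D k s)) := by
  refine backward_induction (P := fun s => Tendsto (fun n => backward (lo n) (up n) D k s) l
    (𝓝 (backward lo' up' D k s))) k (fun s h => ?_) (fun s h h₀ h₁ => ?_) s
  · simp only [backward_of_le h]
    exact tendsto_const_nhds
  · simp only [backward_of_lt h]
    exact tendsto_branch (hlo s) (hup s) h₀ h₁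

/-! ### Supermartingales -/

namespace ForecastingSystem

variable (φ : ForecastingSystem) (s : Situation)

theorem lower_mem : φ.lower s ∈ Icc (0 : ℝ) 1 := (φ s).fst.2

theorem upper_mem : φ.upper s ∈ Icc (0 : ℝ) 1 := (φ s).snd.2

theorem lower_le_upper : φ.lower s ≤ φ.upper s := (φ s).fst_le_snd

end ForecastingSystem

variable {φ : ForecastingSystem}

theorem upperExpect_eq_branch (φ : ForecastingSystem) (s : Situation) (f : Bool → ℝ) :
    upperExpect (φ s) f = branch (φ.lower s) (φ.upper s) (f false) (f true) := by
  refine (isGreatest_upperExpect (φ s) f).unique ⟨?_, ?_⟩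
  · rcases le_total (f false) (f true) with h | h
    · refine ⟨(φ s).snd, NonemptyInterval.mem_def.2 ⟨(φ s).fst_le_snd, le_rfl⟩, ?_⟩
      simp only [branch_of_le h, expect, ForecastingSystem.upper]
      ring
    · refine ⟨(φ s).fst, NonemptyInterval.mem_def.2 ⟨le_rfl, (φ s).fst_le_snd⟩, ?_⟩
      simp only [branch_of_ge h, expect, ForecastingSystem.lower]
      ring
  · rintro _ ⟨p, hp, rfl⟩
    obtain ⟨h₁, h₂⟩ := NonemptyInterval.mem_def.1 hp
    have h₁' : φ.lower s ≤ p := h₁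
    have h₂' : p ≤ φ.upper s := h₂
    simp only [expect]
    rcases le_total (f false) (f true) with h | h
    · rw [branch_of_le h]
      nlinarith
    · rw [branch_of_ge h]
      nlinarith

theorem isSupermartingale_iff {M : Situation → ℝ} : IsSupermartingale φ M ↔
    ∀ s, branch (φ.lower s) (φ.upper s) (M (s ++ [false])) (M (s ++ [true])) ≤ M s := by
  refine forall_congr' fun s => ?_
  rw [upperExpect_eq_branch]
  have : branch (φ.lower s) (φ.upper s) (M (s ++ [false]) - M s) (M (s ++ [true]) - M s)
      = branch (φ.lower s) (φ.upper s) (M (s ++ [false])) (M (s ++ [true])) - M s := by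
    simp only [branch, sub_sub_sub_cancel_right]
    ring
  rw [this, sub_nonpos]

theorem OutcomePath.upTo_succ (ω : OutcomePath) (n : ℕ) :
    OutcomePath.upTo ω (n + 1) = OutcomePath.upTo ω n ++ [ω n] := by
  rw [OutcomePath.upTo, List.ofFn_succ_last]
  rfl

@[simp]
theorem OutcomePath.length_upTo (ω : OutcomePath) (n : ℕ) : (OutcomePath.upTo ω n).length = n := by
  simp [OutcomePath.upTo]

theorem OutcomePath.take_upTo (ω : OutcomePath) {m n : ℕ} (h : m ≤ n) :
    (OutcomePath.upTo ω n).take m = OutcomePath.upTo ω m := by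
  refine List.ext_getElem (by simpa) fun i h₁ h₂ => ?_
  simp [OutcomePath.upTo]

theorem upTo_length_of_mem_cylinder {ω : OutcomePath} {s : Situation} (h : ω ∈ cylinder s) :
    OutcomePath.upTo ω s.length = s := by
  obtain ⟨n, rfl⟩ := h
  simp

/-- Every choice of a next outcome in every situation determines a path through `s`. -/
theorem exists_path_of_choice (x : Situation → Bool) (s : Situation) :
    ∃ ω ∈ cylinder s, ∀ n, s.length ≤ n → ω n = x (OutcomePath.upTo ω n) := by
  let σ : ℕ → Situation := fun m => (fun t => t ++ [x t])^[m] s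
  have hσ (m) : σ (m + 1) = σ m ++ [x (σ m)] := Function.iterate_succ_apply' _ _ _
  have hlen (m) : (σ m).length = s.length + m := by
    induction m with
    | zero => rfl
    | succ m ih => simp [hσ, ih, add_assoc]
  have hpre {m m' : ℕ} (h : m ≤ m') : σ m <+: σ m' := by
    induction m', h using Nat.le_induction with
    | base => exact List.prefix_rfl
    | succ m' _ ih => exact ih.trans (hσ m' ▸ List.prefix_append _ _)
  -- The default `false` is never used, since `σ (n + 1)` has more than `n` entries.
  let ω : OutcomePath := fun n => (σ (n + 1)).getD n false
  have hω (m) : OutcomePath.upTo ω (s.length + m) = σ m := by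
    refine List.ext_getElem (by simp [hlen]) fun i h₁ h₂ => ?_
    have hi : i < (σ (i + 1)).length := by rw [hlen]; omega
    simp only [OutcomePath.upTo, List.getElem_ofFn, ω, List.getD_eq_getElem _ _ hi]
    rcases le_total m (i + 1) with h | h
    · exact ((hpre h).getElem h₂).symm
    · exact (hpre h).getElem hi
  refine ⟨ω, ⟨s.length, hω 0⟩, fun n hn => ?_⟩
  obtain ⟨m, rfl⟩ := Nat.exists_eq_add_of_le hn
  have h := hω (m + 1)
  rw [← add_assoc, OutcomePath.upTo_succ, hσ, hω m] at h
  rw [hω m]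
  simpa using h

theorem IsSupermartingale.exists_le {M : Situation → ℝ} (hM : IsSupermartingale φ M)
    (s : Situation) : ∃ x, M (s ++ [x]) ≤ M s := by
  have h := (min_le_branch (φ.lower_mem s) (φ.upper_mem s)).trans (isSupermartingale_iff.1 hM s)
  rcases min_le_iff.1 h with h | h
  exacts [⟨_, h⟩, ⟨_, h⟩]

/-- A supermartingale dominates in `s` every lower bound on its limits inferior on the paths
through `s`. -/
theorem IsSupermartingale.le_of_le_liminf {M : Situation → ℝ} (hM : IsSupermartingale φ M)
    {s : Situation} {c : ℝ} (h : ∀ ω ∈ cylinder s,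
      (c : EReal) ≤ liminf (fun n => (M (OutcomePath.upTo ω n) : EReal)) atTop) : c ≤ M s := by
  -- Follow a path through `s` along which `M` never increases; its limit inferior there is at most
  -- `M s`.
  choose x hx using hM.exists_le
  obtain ⟨ω, hω, hω'⟩ := exists_path_of_choice x s
  have hle : ∀ n, s.length ≤ n → M (OutcomePath.upTo ω n) ≤ M s := by
    intro n hn
    induction n, hn using Nat.le_induction with
    | base => rw [upTo_length_of_mem_cylinder hω]
    | succ n hn ih =>
      rw [OutcomePath.upTo_succ, hω' n hn]
      exact (hx _).trans ih
  have : liminf (fun n => (M (OutcomePath.upTo ω n) : EReal)) atTop ≤ (M s : EReal) := by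
    refine liminf_le_of_frequently_le' (Eventually.frequently ?_)
    filter_upwards [eventually_ge_atTop s.length] with n hn
    exact_mod_cast hle n hn
  exact_mod_cast (h ω hω).trans this

/-! ### Upper probabilities -/

theorem mem_cylinder_nil (ω : OutcomePath) : ω ∈ cylinder [] := ⟨0, rfl⟩

theorem upperProb_le {G : Set OutcomePath} {M : Situation → ℝ} (hM : IsSupermartingale φ M)
    (h : ∀ ω, ((G.indicator (fun _ => 1) ω : ℝ) : EReal)
      ≤ liminf (fun n => (M (OutcomePath.upTo ω n) : EReal)) atTop) : upperProb φ G ≤ M [] := by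
  -- The real infimum needs a lower bound: an admissible supermartingale is non-negative at the
  -- root, as indicators are.
  refine csInf_le ⟨0, ?_⟩ ⟨M, hM, fun ω _ => h ω, rfl⟩
  rintro _ ⟨M', hM', h', rfl⟩
  refine hM'.le_of_le_liminf fun ω hω => le_trans ?_ (h' ω hω)
  exact_mod_cast indicator_nonneg (fun _ _ => zero_le_one) ω

theorem isSupermartingale_const (φ : ForecastingSystem) (c : ℝ) :
    IsSupermartingale φ fun _ => c :=
  isSupermartingale_iff.2 fun _ => (branch_self ..).le

theorem le_upperProb {G : Set OutcomePath} {c : ℝ}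
    (h : ∀ M, IsSupermartingale φ M → (∀ ω, ((G.indicator (fun _ => 1) ω : ℝ) : EReal)
      ≤ liminf (fun n => (M (OutcomePath.upTo ω n) : EReal)) atTop) → c ≤ M []) :
    c ≤ upperProb φ G := by
  refine le_csInf ⟨1, fun _ => 1, isSupermartingale_const φ 1, fun ω _ => ?_, rfl⟩ ?_
  · rw [liminf_const]
    exact_mod_cast indicator_le_self' (s := G) (f := fun _ => (1 : ℝ)) (fun _ _ => zero_le_one) ω
  · rintro _ ⟨M, hM, hω, rfl⟩
    exact h M hM fun ω => hω ω (mem_cylinder_nil ω)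

theorem mem_cylinderUnion {S : Set Situation} {ω : OutcomePath} :
    ω ∈ cylinderUnion S ↔ ∃ n, OutcomePath.upTo ω n ∈ S := by
  simp only [cylinderUnion, mem_iUnion, cylinder, mem_ofPred_eq]
  constructor
  · rintro ⟨s, hs, n, rfl⟩
    exact ⟨n, hs⟩
  · rintro ⟨n, hn⟩
    exact ⟨_, hn, n, rfl⟩

theorem OutcomePath.upTo_prefix (ω : OutcomePath) {m n : ℕ} (h : m ≤ n) :
    OutcomePath.upTo ω m <+: OutcomePath.upTo ω n := by
  rw [← OutcomePath.take_upTo ω h]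
  exact List.take_prefix ..

/-- Ville's inequality: a test supermartingale exceeds `c` with upper probability at most `1 / c`. -/
theorem IsTestSupermartingale.upperProb_le {T : Situation → ℝ} (hT : IsTestSupermartingale φ T)
    {c : ℝ} (hc : 1 ≤ c) : upperProb φ (cylinderUnion {s | c < T s}) ≤ 1 / c := by
  classical
  obtain ⟨hsup, hnn, hone⟩ := hT
  have hc₀ : 0 < c := by linarith
  -- `T / c`, frozen at `1` once `T` has exceeded `c`. At the crossing `T / c` is larger than `1`,
  -- so freezing only lowers the value and preserves the supermartingale inequality.
  let M : Situation → ℝ := fun s => if ∃ t, t <+: s ∧ c < T t then 1 else T s / c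
  have hMle (s) (hs : ¬ ∃ t, t <+: s ∧ c < T t) (x : Bool) : M (s ++ [x]) ≤ T (s ++ [x]) / c := by
    simp only [M]
    split_ifs with h
    · obtain ⟨t, ht, hct⟩ := h
      rcases List.prefix_concat_iff.1 ht with rfl | ht
      · exact (one_le_div hc₀).2 hct.le
      · exact absurd ⟨t, ht, hct⟩ hs
    · exact le_rfl
  have hM : IsSupermartingale φ M := by
    refine isSupermartingale_iff.2 fun s => ?_
    by_cases hs : ∃ t, t <+: s ∧ c < T t
    · obtain ⟨t, ht, hct⟩ := hs
      have h (x : Bool) : M (s ++ [x]) = 1 := if_pos ⟨t, ht.trans (List.prefix_append _ _), hct⟩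
      have h' : M s = 1 := if_pos ⟨t, ht, hct⟩
      rw [h, h, h', branch_self]
    · refine (branch_mono (φ.lower_mem s) (φ.upper_mem s) (hMle s hs _) (hMle s hs _)).trans ?_
      have : branch (φ.lower s) (φ.upper s) (T (s ++ [false]) / c) (T (s ++ [true]) / c)
          = branch (φ.lower s) (φ.upper s) (T (s ++ [false])) (T (s ++ [true])) / c := by
        have hmax (x : ℝ) : max (x / c) 0 = max x 0 / c := by
          simpa using max_div_div_right hc₀.le x 0
        simp only [branch, ← sub_div, hmax]
        ring
      rw [this, show M s = T s / c from if_neg hs]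
      exact div_le_div_of_nonneg_right (isSupermartingale_iff.1 hsup s) hc₀.le
  have hM₀ (s) : 0 ≤ M s := by
    simp only [M]
    split_ifs
    exacts [zero_le_one, div_nonneg (hnn s) hc₀.le]
  have hroot : M [] = 1 / c := by
    have : ¬ ∃ t, t <+: ([] : Situation) ∧ c < T t := by
      rintro ⟨t, ht, hct⟩
      rw [List.prefix_nil.1 ht, hone] at hct
      linarith
    rw [show M [] = T [] / c from if_neg this, hone]
  rw [← hroot]
  refine ImpreciseRandomness.upperProb_le hM fun ω => ?_
  by_cases hω : ω ∈ cylinderUnion {s | c < T s}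
  · obtain ⟨m, hm⟩ := mem_cylinderUnion.1 hω
    rw [indicator_of_mem hω]
    refine le_liminf_of_le (by isBoundedDefault) ?_
    filter_upwards [eventually_ge_atTop m] with n hn
    have : M (OutcomePath.upTo ω n) = 1 := if_pos ⟨_, OutcomePath.upTo_prefix ω hn, hm⟩
    rw [this]
  · rw [indicator_of_notMem hω]
    refine le_liminf_of_le (by isBoundedDefault) (Eventually.of_forall fun n => ?_)
    exact_mod_cast hM₀ _

/-- The strict inequality holds exactly when some rational approximation from below already exceeds
the threshold, and this can be searched for. -/
theorem LowerSemicomputable.rePred_lt {D : Type*} [Primcodable D] {r : D → ℝ}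
    (hr : LowerSemicomputable r) {c : ℕ → ℚ} (hc : Computable c) :
    REPred fun a : ℕ × D => (c a.1 : ℝ) < r a.2 := by
  obtain ⟨q, hq, hmono, hlim⟩ := hr
  have hq' : Computable q := Computable.rat_iff.2 hq
  have h₁ : Computable fun p : (ℕ × D) × ℕ => (p.1.2, p.2) :=
    (Computable.snd.comp .fst).pair .snd
  have h₂ := (ComputablePred.rat_lt (hc.comp (Computable.fst.comp .fst)) (hq'.comp h₁)).decide
  refine (Partrec.rfind (p := fun (a : ℕ × D) (n : ℕ) =>
    Part.some (decide (c a.1 < q (a.2, n)))) h₂).dom_re.of_eq fun a => ?_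
  refine Nat.rfind_dom.trans ?_
  have hm : Monotone fun n => (q (a.2, n) : ℝ) :=
    monotone_nat_of_le_succ fun n => by exact_mod_cast hmono a.2 n
  constructor
  · rintro ⟨n, hn, -⟩
    have hn' : c a.1 < q (a.2, n) := of_decide_eq_true (Part.mem_some_iff.1 hn).symm
    have : (c a.1 : ℝ) < q (a.2, n) := by exact_mod_cast hn'
    exact this.trans_le (hm.ge_of_tendsto (hlim a.2) n)
  · intro h
    obtain ⟨n, hn⟩ := ((hlim a.2).eventually_const_lt h).exists
    have hn' : c a.1 < q (a.2, n) := by exact_mod_cast hn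
    exact ⟨n, Part.mem_some_iff.2 (decide_eq_true hn').symm, fun _ => trivial⟩

theorem IsMartinLofTestRandom.isMartinLofRandom {ω : OutcomePath}
    (h : IsMartinLofTestRandom φ ω) : IsMartinLofRandom φ ω := by
  intro T hT hlsc
  by_contra! hunb
  refine h (fun n => cylinderUnion {s | (2 : ℝ) ^ n < T s})
    ⟨{a | (2 : ℝ) ^ a.1 < T a.2}, ?_, fun n => ⟨rfl, ?_⟩⟩ ?_
  · have := hlsc.rePred_lt (Computable.rat_pow 2 .id)
    push_cast at this
    exact this
  · rw [one_div_pow]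
    exact hT.upperProb_le (one_le_pow₀ one_le_two)
  · refine mem_iInter.2 fun n => mem_cylinderUnion.2 ?_
    exact hunb (2 ^ n)

/-! ### Effective approximations of computable functions with values in the unit interval -/

/-- Effective monotone rational approximations of `r`, from below and from above. -/
structure UnitApproximation (r : Situation → ℝ) where
  below : ℕ → Situation → ℚ
  above : ℕ → Situation → ℚ
  below_mem : ∀ n s, below n s ∈ Icc 0 1
  above_mem : ∀ n s, above n s ∈ Icc 0 1
  monotone_below : ∀ s, Monotone fun n => below n s
  antitone_above : ∀ s, Antitone fun n => above n s
  tendsto_below : ∀ s, Tendsto (fun n => (below n s : ℝ)) atTop (𝓝 (r s))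
  tendsto_above : ∀ s, Tendsto (fun n => (above n s : ℝ)) atTop (𝓝 (r s))
  computable_below : Computable fun p : ℕ × Situation => below p.1 p.2
  computable_above : Computable fun p : ℕ × Situation => above p.1 p.2

/-- Clamping the approximations to the unit interval keeps them monotone and does not affect the
limit. -/
theorem LowerSemicomputable.exists_unit_approximation {r : Situation → ℝ}
    (h : LowerSemicomputable r) (hr : ∀ s, r s ∈ Icc (0 : ℝ) 1) :
    ∃ q : ℕ → Situation → ℚ, (∀ n s, q n s ∈ Icc 0 1) ∧ (∀ s, Monotone fun n => q n s) ∧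
      (∀ s, Tendsto (fun n => (q n s : ℝ)) atTop (𝓝 (r s))) ∧
      Computable fun p : ℕ × Situation => q p.1 p.2 := by
  obtain ⟨q, hq, hmono, hlim⟩ := h
  refine ⟨fun n s => max 0 (min 1 (q (s, n))), fun n s => ⟨le_max_left _ _, by simp⟩, fun s => ?_,
    fun s => ?_, ?_⟩
  · have : Monotone fun n => q (s, n) := monotone_nat_of_le_succ (hmono s)
    exact fun m n hmn => max_le_max le_rfl (min_le_min le_rfl (this hmn))
  · have h₁ : r s = max 0 (min 1 (r s)) := by rw [min_eq_right (hr s).2, max_eq_right (hr s).1]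
    rw [h₁]
    push_cast
    exact tendsto_const_nhds.max (tendsto_const_nhds.min (hlim s))
  · have hq' : Computable q := Computable.rat_iff.2 hq
    have h₂ : Computable fun p : ℕ × Situation => q (p.2, p.1) :=
      hq'.comp (Computable.snd.pair .fst)
    exact (Computable.const 0).rat_max ((Computable.const 1).rat_min h₂)

theorem LowerSemicomputable.const_add {D : Type*} [Primcodable D] {r : D → ℝ}
    (h : LowerSemicomputable r) (c : ℚ) : LowerSemicomputable fun d => c + r d := by
  obtain ⟨q, hq, hmono, hlim⟩ := h
  refine ⟨fun p => c + q p, Computable.rat_iff.1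
    ((Computable.const c).rat_add (Computable.rat_iff.2 hq)), fun d n => ?_, fun d => ?_⟩
  · exact add_le_add_right (hmono d n) c
  · push_cast
    exact tendsto_const_nhds.add (hlim d)

theorem ComputableReal.nonempty_unitApproximation {r : Situation → ℝ} (h : ComputableReal r)
    (hr : ∀ s, r s ∈ Icc (0 : ℝ) 1) : Nonempty (UnitApproximation r) := by
  obtain ⟨q, hq, hmono, hlim, hcomp⟩ := h.1.exists_unit_approximation hr
  -- Approximations of `1 - r` from below; their reflections approximate `r` from above.
  obtain ⟨q', hq', hmono', hlim', hcomp'⟩ := (h.2.const_add 1).exists_unit_approximation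
    fun s => ⟨by have := (hr s).2; push_cast; linarith, by have := (hr s).1; push_cast; linarith⟩
  exact ⟨{
    below := q
    above := fun n s => 1 - q' n s
    below_mem := hq
    above_mem := fun n s => ⟨sub_nonneg.2 (hq' n s).2, sub_le_self _ (hq' n s).1⟩
    monotone_below := hmono
    antitone_above := fun s m n hmn => sub_le_sub_left (hmono' s hmn) 1
    tendsto_below := hlim
    tendsto_above := fun s => by
      have := (hlim' s).const_sub 1
      simpa using this
    computable_below := hcomp
    computable_above := (Computable.const 1).rat_sub hcomp' }⟩

namespace UnitApproximation

variable {r : Situation → ℝ} (a : UnitApproximation r)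

theorem below_le (n : ℕ) (s : Situation) : (a.below n s : ℝ) ≤ r s :=
  Monotone.ge_of_tendsto (fun _ _ h => by exact_mod_cast a.monotone_below s h) (a.tendsto_below s) n

theorem le_above (n : ℕ) (s : Situation) : r s ≤ a.above n s :=
  Antitone.le_of_tendsto (fun _ _ h => by exact_mod_cast a.antitone_above s h) (a.tendsto_above s) n

theorem below_le_above (m n : ℕ) (s : Situation) : a.below m s ≤ a.above n s := by
  exact_mod_cast (a.below_le m s).trans (a.le_above n s)

end UnitApproximation

/-! ### Growth of non-negative supermartingales -/

theorem ForecastingSystem.NonDegenerate.exists_growth_bound (hnd : φ.NonDegenerate) :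
    ∃ C : Situation → ℝ, (∀ s, 0 ≤ C s) ∧ ∀ V : Situation → ℝ, (∀ s, 0 ≤ V s) →
      (∀ s, φ.upper s * V (s ++ [true]) ≤ V s) → (∀ s, (1 - φ.lower s) * V (s ++ [false]) ≤ V s) →
      ∀ s, V s ≤ C s * V [] := by
  suffices h : ∀ s, ∃ C : ℝ, 0 ≤ C ∧ ∀ V : Situation → ℝ, (∀ s, 0 ≤ V s) →
      (∀ s, φ.upper s * V (s ++ [true]) ≤ V s) → (∀ s, (1 - φ.lower s) * V (s ++ [false]) ≤ V s) →
      V s ≤ C * V [] by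
    choose C hC hV using h
    exact ⟨C, hC, fun V h₀ h₁ h₂ s => hV s V h₀ h₁ h₂⟩
  intro s
  induction s using List.reverseRecOn with
  | nil => exact ⟨1, zero_le_one, fun V _ _ _ => by simp⟩
  | append_singleton s x ih =>
    obtain ⟨C, hC, hV⟩ := ih
    have hpos : 0 < if x then φ.upper s else 1 - φ.lower s := by
      split
      exacts [(hnd s).2, sub_pos.2 (hnd s).1]
    -- One more outcome divides the constant by the greatest probability the forecast allows for
    -- that outcome, which is positive by non-degeneracy.
    refine ⟨C / if x then φ.upper s else 1 - φ.lower s, by positivity, fun V h₀ h₁ h₂ => ?_⟩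
    rw [div_mul_eq_mul_div, le_div_iff₀ hpos, mul_comm]
    refine le_trans ?_ (hV V h₀ h₁ h₂)
    cases x
    exacts [h₂ s, h₁ s]

/-! ### Backward recursion and upper probabilities -/

/-- At depth `k` the bound on the limits inferior forces `M` to dominate the indicator of `D`;
monotonicity of `branch` carries this back to the root. -/
theorem backward_le_of_le_liminf {D : Situation → Bool} {k : ℕ} {M : Situation → ℝ}
    (hM : IsSupermartingale φ M)
    (h : ∀ ω, (((cylinderUnion {s | D s}).indicator (fun _ => 1) ω : ℝ) : EReal)
      ≤ liminf (fun n => (M (OutcomePath.upTo ω n) : EReal)) atTop) (s : Situation) :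
    backward φ.lower φ.upper D k s ≤ M s := by
  refine backward_induction (P := fun s => backward φ.lower φ.upper D k s ≤ M s) k (fun s hs => ?_)
    (fun s hs h₀ h₁ => ?_) s
  · refine hM.le_of_le_liminf fun ω hω => le_trans ?_ (h ω)
    rw [backward_of_le hs]
    refine EReal.coe_le_coe_iff.2 ?_
    split_ifs with hD
    · have hmem : ω ∈ cylinderUnion {s | D s} :=
        mem_cylinderUnion.2 ⟨s.length, by rwa [upTo_length_of_mem_cylinder hω]⟩
      rw [indicator_of_mem hmem]
    · exact indicator_nonneg (fun _ _ => zero_le_one) ω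
  · rw [backward_of_lt hs]
    exact (branch_mono (φ.lower_mem s) (φ.upper_mem s) h₀ h₁).trans (isSupermartingale_iff.1 hM s)

theorem backward_le_upperProb (φ : ForecastingSystem) (D : Situation → Bool) (k : ℕ) :
    backward φ.lower φ.upper D k [] ≤ upperProb φ (cylinderUnion {s | D s}) :=
  le_upperProb fun _ hM h => backward_le_of_le_liminf hM h []

theorem upperProb_mono {G G' : Set OutcomePath} (h : G ⊆ G') : upperProb φ G ≤ upperProb φ G' :=
  le_upperProb fun _ hM hω => upperProb_le hM fun ω => le_trans
    (by exact_mod_cast indicator_le_indicator_of_subset h (fun _ => zero_le_one) ω) (hω ω)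

/-! ### The universal supermartingale of a sequence of increasing stopping sets -/

/-- Sequences of sets of situations that are enumerated in stages. -/
structure IsStaged (D : ℕ → ℕ → Situation → Bool) : Prop where
  decided : ∀ i k, IsDecidedBy (D i k) k
  mono : ∀ i s {k k'}, k ≤ k' → D i k s → D i k' s
  zero : ∀ i s, D i 0 s = false

section universal

variable (D : ℕ → ℕ → Situation → Bool) (L : UnitApproximation φ.lower)
  (U : UnitApproximation φ.upper)

/-- The approximation from below of the conditional upper probabilities of the `k`-th stage. -/
def innerValue (i k j : ℕ) (s : Situation) : ℚ := backward (L.above j) (U.below j) (D i k) k s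

/-- The approximation from above of the conditional upper probabilities of the `k`-th stage. -/
def outerValue (i k j : ℕ) (s : Situation) : ℚ := backward (L.below j) (U.above j) (D i k) k s

/-- The `k`-th stage is known, after `j` steps, to have upper probability less than `2⁻⁽ⁱ⁺¹⁾`. -/
abbrev IsAccepted (i j k : ℕ) : Prop := outerValue D L U i k j [] < (1 / 2) ^ (i + 1)

/-- The last stage that is accepted after `j` steps. -/
def lastStage (i j : ℕ) : ℕ := Nat.findGreatest (IsAccepted D L U i j) j

/-- The `j`-th approximation of the `i`-th summand of the universal supermartingale. -/
def summandApprox (i j : ℕ) (s : Situation) : ℚ := innerValue D L U i (lastStage D L U i j) j s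

/-- The `i`-th summand of the universal supermartingale. -/
noncomputable def summand (i : ℕ) (s : Situation) : ℝ := ⨆ j, (summandApprox D L U i j s : ℝ)

/-- The sum of the summands, normalized in the initial situation. -/
noncomputable def universal (s : Situation) : ℝ := if s = [] then 1 else ∑' i, summand D L U i s

/-- The rational approximations of the universal supermartingale. -/
def universalApprox (s : Situation) (j : ℕ) : ℚ :=
  if s = [] then 1 else ∑ i ∈ Finset.range j, summandApprox D L U i j s

variable {D} (hD : IsStaged D) (i k j : ℕ) (s : Situation)

theorem innerValue_nonneg : 0 ≤ innerValue D L U i k j s :=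
  backward_nonneg (L.above_mem j) (U.below_mem j) s

theorem outerValue_nonneg : 0 ≤ outerValue D L U i k j s :=
  backward_nonneg (L.below_mem j) (U.above_mem j) s

include hD

theorem innerValue_le_outerValue : innerValue D L U i k j s ≤ outerValue D L U i k j s :=
  backward_mono (L.above_mem j) (U.below_mem j) (L.below_mem j) (U.above_mem j)
    (L.below_le_above j j) (U.below_le_above j j) (hD.decided i k) (fun _ h => h) le_rfl s

theorem innerValue_mono {k k' j j' : ℕ} (hk : k ≤ k') (hj : j ≤ j') :
    innerValue D L U i k j s ≤ innerValue D L U i k' j' s :=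
  backward_mono (L.above_mem j) (U.below_mem j) (L.above_mem j') (U.below_mem j')
    (fun s => L.antitone_above s hj) (fun s => U.monotone_below s hj) (hD.decided i k')
    (fun s => hD.mono i s hk) hk s

theorem outerValue_antitone {j j' : ℕ} (hj : j ≤ j') :
    outerValue D L U i k j' s ≤ outerValue D L U i k j s :=
  backward_mono (L.below_mem j') (U.above_mem j') (L.below_mem j) (U.above_mem j)
    (fun s => L.monotone_below s hj) (fun s => U.antitone_above s hj) (hD.decided i k)
    (fun _ h => h) le_rfl s

/-- Acceptance is never withdrawn, so the last accepted stage can only grow with `j`. -/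
theorem isAccepted_mono {j j' : ℕ} (hj : j ≤ j') (h : IsAccepted D L U i j k) :
    IsAccepted D L U i j' k := (outerValue_antitone L U hD i k [] hj).trans_lt h

/-- Stage `0` is empty, so the default value `0` of `Nat.findGreatest` is an accepted stage too. -/
theorem isAccepted_zero : IsAccepted D L U i j 0 := by
  rw [IsAccepted, outerValue, backward_of_le (Nat.zero_le _), hD.zero i]
  simp

theorem isAccepted_lastStage : IsAccepted D L U i j (lastStage D L U i j) :=
  Nat.findGreatest_spec (P := IsAccepted D L U i j) (Nat.zero_le j) (isAccepted_zero L U hD i j)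

theorem lastStage_mono : Monotone (lastStage D L U i) := fun _ _ hj =>
  Nat.findGreatest_mono (fun k => isAccepted_mono L U hD i k hj) hj

theorem summandApprox_mono : Monotone fun j => summandApprox D L U i j s := fun _ _ hj =>
  innerValue_mono L U hD i s (lastStage_mono L U hD i hj) hj

theorem summandApprox_eq_branch : summandApprox D L U i j s = branch (L.above j s) (U.below j s)
    (summandApprox D L U i j (s ++ [false])) (summandApprox D L U i j (s ++ [true])) :=
  backward_eq (hD.decided i _) s

variable {C : Situation → ℝ} (hC₀ : ∀ s, 0 ≤ C s) (hC : ∀ V : Situation → ℝ, (∀ s, 0 ≤ V s) →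
  (∀ s, φ.upper s * V (s ++ [true]) ≤ V s) → (∀ s, (1 - φ.lower s) * V (s ++ [false]) ≤ V s) →
  ∀ s, V s ≤ C s * V [])

include hC₀ hC

/-- The outer value dominates the inner one, is small at the root by acceptance, and obeys the
growth bound because its intervals enclose the forecasts. -/
theorem summandApprox_le : (summandApprox D L U i j s : ℝ) ≤ C s * (1 / 2) ^ (i + 1) := by
  set k := lastStage D L U i j with hk
  have h₀ (s) : (0 : ℝ) ≤ outerValue D L U i k j s := by exact_mod_cast outerValue_nonneg L U i k j s
  have hle (s) : L.below j s ≤ U.above j s := by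
    exact_mod_cast (L.below_le j s).trans ((φ.lower_le_upper s).trans (U.le_above j s))
  have hb (s) : outerValue D L U i k j s = branch (L.below j s) (U.above j s)
      (outerValue D L U i k j (s ++ [false])) (outerValue D L U i k j (s ++ [true])) :=
    backward_eq (hD.decided i k) s
  have h₁ (s) : φ.upper s * outerValue D L U i k j (s ++ [true]) ≤ outerValue D L U i k j s := by
    have h : U.above j s * outerValue D L U i k j (s ++ [true]) ≤ outerValue D L U i k j s :=
      hb s ▸ mul_le_branch_right (hle s) (U.above_mem j s).2 (outerValue_nonneg L U i k j _)
    refine (mul_le_mul_of_nonneg_right (U.le_above j s) (h₀ _)).trans ?_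
    exact_mod_cast h
  have h₂ (s) : (1 - φ.lower s) * outerValue D L U i k j (s ++ [false])
      ≤ outerValue D L U i k j s := by
    have h : (1 - L.below j s) * outerValue D L U i k j (s ++ [false])
        ≤ outerValue D L U i k j s :=
      hb s ▸ mul_le_branch_left (hle s) (L.below_mem j s).1 (outerValue_nonneg L U i k j _)
    refine (mul_le_mul_of_nonneg_right (sub_le_sub_left (L.below_le j s) 1) (h₀ _)).trans ?_
    exact_mod_cast h
  have hacc : (outerValue D L U i k j [] : ℝ) ≤ (1 / 2) ^ (i + 1) := by
    exact (Rat.cast_le.2 (isAccepted_lastStage L U hD i j).le).trans_eq (by push_cast; rfl)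
  calc (summandApprox D L U i j s : ℝ) ≤ outerValue D L U i k j s := by
        exact_mod_cast innerValue_le_outerValue L U hD i k j s
    _ ≤ C s * outerValue D L U i k j [] := hC _ h₀ h₁ h₂ s
    _ ≤ C s * (1 / 2) ^ (i + 1) := mul_le_mul_of_nonneg_left hacc (hC₀ s)

theorem bddAbove_summandApprox : BddAbove (range fun j => (summandApprox D L U i j s : ℝ)) :=
  ⟨_, forall_mem_range.2 fun j => summandApprox_le L U hD i j s hC₀ hC⟩

theorem summandApprox_le_summand : (summandApprox D L U i j s : ℝ) ≤ summand D L U i s :=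
  le_ciSup (bddAbove_summandApprox L U hD i s hC₀ hC) j

theorem tendsto_summandApprox :
    Tendsto (fun j => (summandApprox D L U i j s : ℝ)) atTop (𝓝 (summand D L U i s)) :=
  tendsto_atTop_ciSup (fun _ _ hj => by exact_mod_cast summandApprox_mono L U hD i s hj)
    (bddAbove_summandApprox L U hD i s hC₀ hC)

theorem summand_nonneg : 0 ≤ summand D L U i s :=
  le_trans (by exact_mod_cast innerValue_nonneg L U i _ 0 s)
    (summandApprox_le_summand L U hD i 0 s hC₀ hC)

theorem summand_le : summand D L U i s ≤ C s * (1 / 2) ^ (i + 1) :=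
  ciSup_le fun j => summandApprox_le L U hD i j s hC₀ hC

theorem summand_eq_branch : summand D L U i s = branch (φ.lower s) (φ.upper s)
    (summand D L U i (s ++ [false])) (summand D L U i (s ++ [true])) := by
  refine tendsto_nhds_unique (tendsto_summandApprox L U hD i s hC₀ hC) ?_
  refine (tendsto_branch (L.tendsto_above s) (U.tendsto_below s)
    (tendsto_summandApprox L U hD i _ hC₀ hC) (tendsto_summandApprox L U hD i _ hC₀ hC)).congr
    fun j => ?_
  rw [← cast_branch, ← summandApprox_eq_branch L U hD]

omit hD hC₀ hC in
theorem hasSum_half_pow_succ (c : ℝ) : HasSum (fun i : ℕ => c * (1 / 2) ^ (i + 1)) c := by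
  convert hasSum_geometric_two' c using 2 with i
  rw [pow_succ, one_div_pow]
  ring

theorem summable_summand : Summable fun i => summand D L U i s :=
  Summable.of_nonneg_of_le (fun i => summand_nonneg L U hD i s hC₀ hC)
    (fun i => summand_le L U hD i s hC₀ hC) (hasSum_half_pow_succ (C s)).summable

theorem tsum_summand_le : ∑' i, summand D L U i s ≤ C s :=
  (summable_summand L U hD s hC₀ hC).tsum_le_of_sum_le fun t =>
    (Finset.sum_le_sum fun i _ => summand_le L U hD i s hC₀ hC).trans
      (sum_le_hasSum t (fun i _ => mul_nonneg (hC₀ s) (by positivity)) (hasSum_half_pow_succ (C s)))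

/-- `branch` is not linear, but each of the two linear inequalities in `branch_le_iff` can be summed
term by term. -/
theorem branch_tsum_summand_le : branch (φ.lower s) (φ.upper s) (∑' i, summand D L U i (s ++ [false]))
    (∑' i, summand D L U i (s ++ [true])) ≤ ∑' i, summand D L U i s := by
  have h₀ := (summable_summand L U hD (s ++ [false]) hC₀ hC).hasSum
  have h₁ := (summable_summand L U hD (s ++ [true]) hC₀ hC).hasSum
  have h := (summable_summand L U hD s hC₀ hC).hasSum
  have hle (i) := (branch_le_iff (φ.lower_le_upper s)).1 (summand_eq_branch L U hD i s hC₀ hC).ge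
  exact (branch_le_iff (φ.lower_le_upper s)).2
    ⟨hasSum_le (fun i => (hle i).1) (h₀.add ((h₁.sub h₀).mul_left _)) h,
      hasSum_le (fun i => (hle i).2) (h₀.add ((h₁.sub h₀).mul_left _)) h⟩

omit hC₀ hC in
theorem tsum_summand_nil_le (hnd : φ.NonDegenerate) : ∑' i, summand D L U i [] ≤ 1 := by
  obtain ⟨C, hC₀, hC⟩ := hnd.exists_growth_bound
  -- The growth constant at the root may be replaced by `1`, since there the bound is trivial.
  refine tsum_summand_le L U hD [] (C := fun s => if s = [] then 1 else C s) (fun s => ?_)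
    fun V h₀ h₁ h₂ s => ?_
  · split_ifs
    exacts [zero_le_one, hC₀ s]
  · split_ifs with h
    · rw [h, one_mul]
    · exact hC V h₀ h₁ h₂ s

omit hC₀ hC in
theorem tsum_summand_le_universal (hnd : φ.NonDegenerate) :
    ∑' i, summand D L U i s ≤ universal D L U s := by
  rw [universal]
  split_ifs with h
  · exact h ▸ tsum_summand_nil_le L U hD hnd
  · exact le_rfl

/-- Raising the root value to `1` is harmless: the root is nobody's successor, and the sum there is
at most `1`. -/
theorem isTestSupermartingale_universal (hnd : φ.NonDegenerate) :
    IsTestSupermartingale φ (universal D L U) := by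
  refine ⟨isSupermartingale_iff.2 fun s => ?_, fun s => ?_, if_pos rfl⟩
  · have h (x : Bool) : universal D L U (s ++ [x]) = ∑' i, summand D L U i (s ++ [x]) :=
      if_neg (by simp)
    rw [h, h]
    exact (branch_tsum_summand_le L U hD s hC₀ hC).trans
      (tsum_summand_le_universal L U hD s hnd)
  · exact (tsum_nonneg fun i => summand_nonneg L U hD i s hC₀ hC).trans
      (tsum_summand_le_universal L U hD s hnd)

omit hC₀ hC in
theorem universalApprox_le_succ : universalApprox D L U s j ≤ universalApprox D L U s (j + 1) := by
  rw [universalApprox, universalApprox]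
  split_ifs
  · exact le_rfl
  · rw [Finset.sum_range_succ]
    exact (Finset.sum_le_sum fun i _ => summandApprox_mono L U hD i s (Nat.le_succ j)).trans
      (le_add_of_nonneg_right (innerValue_nonneg L U _ _ _ s))

theorem tendsto_universalApprox :
    Tendsto (fun j => (universalApprox D L U s j : ℝ)) atTop (𝓝 (universal D L U s)) := by
  by_cases hs : s = []
  · simp [universalApprox, universal, hs]
  have h : ∀ j, (universalApprox D L U s j : ℝ)
      = ∑' i, if i < j then (summandApprox D L U i j s : ℝ) else 0 := by
    intro j
    rw [universalApprox, if_neg hs, tsum_eq_sum (s := Finset.range j) fun i hi => by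
      simpa using fun h => absurd h (by simpa using hi)]
    push_cast
    exact Finset.sum_congr rfl fun i hi => (if_pos (Finset.mem_range.1 hi)).symm
  simp only [h, universal, if_neg hs]
  -- The dominating series is `C s * (1 / 2) ^ (i + 1)`, which does not depend on `j`.
  refine tendsto_tsum_of_dominated_convergence (hasSum_half_pow_succ (C s)).summable (fun i => ?_)
    (Eventually.of_forall fun j i => ?_)
  · refine (tendsto_summandApprox L U hD i s hC₀ hC).congr' ?_
    filter_upwards [eventually_gt_atTop i] with j hj
    rw [if_pos hj]
  · split_ifs
    · rw [Real.norm_of_nonneg (by exact_mod_cast innerValue_nonneg L U i _ j s)]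
      exact summandApprox_le L U hD i j s hC₀ hC
    · rw [norm_zero]
      exact mul_nonneg (hC₀ s) (by positivity)

omit hD hC₀ hC in
-- The outer values converge to the exact backward value, which is at most the upper probability;
-- the strict inequality leaves room for a rational witness.
theorem eventually_isAccepted
    (h : upperProb φ (cylinderUnion {s | D i k s}) < (1 / 2) ^ (i + 1)) :
    ∀ᶠ j in atTop, IsAccepted D L U i j k := by
  have hlim : Tendsto (fun j => (outerValue D L U i k j [] : ℝ)) atTop
      (𝓝 (backward φ.lower φ.upper (D i k) k [])) := by
    simp only [outerValue, cast_backward]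
    exact tendsto_backward L.tendsto_below U.tendsto_above (D i k) k []
  filter_upwards [hlim.eventually_lt_const ((backward_le_upperProb φ (D i k) k).trans_lt h)] with j hj
  rw [IsAccepted, ← Rat.cast_lt (K := ℝ)]
  simpa using hj

theorem one_le_summand (h : upperProb φ (cylinderUnion {s | D i k s}) < (1 / 2) ^ (i + 1))
    (hs : D i k s) : 1 ≤ summand D L U i s := by
  obtain ⟨j, hacc, hj⟩ := ((eventually_isAccepted L U i k h).and (eventually_ge_atTop k)).exists
  refine le_trans ?_ (summandApprox_le_summand L U hD i j s hC₀ hC)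
  -- The last accepted stage may be later than `k`, but then it contains the `k`-th one.
  have hk : k ≤ lastStage D L U i j := Nat.le_findGreatest hj hacc
  exact_mod_cast (backward_eq_one (hD.decided i _) s (hD.mono i s hk hs)).ge

/-- Any `N` of the selected summands are eventually at least `1` simultaneously, and the others are
non-negative. -/
theorem tendsto_universal_atTop (hnd : φ.NonDegenerate) {ω : OutcomePath} {f : ℕ → ℕ}
    (hf : Function.Injective f)
    (hω : ∀ m, ∀ᶠ n in atTop, 1 ≤ summand D L U (f m) (OutcomePath.upTo ω n)) :
    Tendsto (fun n => universal D L U (OutcomePath.upTo ω n)) atTop atTop := by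
  refine tendsto_atTop.2 fun B => ?_
  obtain ⟨N, hN⟩ := exists_nat_ge B
  have h : ∀ᶠ n in atTop, ∀ m ∈ Finset.range N, 1 ≤ summand D L U (f m) (OutcomePath.upTo ω n) :=
    (Finset.eventually_all _).2 fun m _ => hω m
  filter_upwards [h] with n hn
  refine hN.trans (le_trans ?_ (tsum_summand_le_universal L U hD _ hnd))
  calc (N : ℝ) = ∑ m ∈ Finset.range N, (1 : ℝ) := by simp
    _ ≤ ∑ m ∈ Finset.range N, summand D L U (f m) (OutcomePath.upTo ω n) := Finset.sum_le_sum hn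
    _ = ∑ i ∈ (Finset.range N).map ⟨f, hf⟩, summand D L U i (OutcomePath.upTo ω n) := by simp
    _ ≤ _ := (summable_summand L U hD _ hC₀ hC).sum_le_tsum _ fun i _ =>
      summand_nonneg L U hD i _ hC₀ hC

end universal

/-! ### Computability of the approximations -/

section computability

variable {D : ℕ → ℕ → Situation → Bool} {L : UnitApproximation φ.lower}
  {U : UnitApproximation φ.upper} {α : Type*} [Primcodable α]

theorem computable_branch {lo up a b : α → ℚ} (hlo : Computable lo) (hup : Computable up)
    (ha : Computable a) (hb : Computable b) :
    Computable fun x => branch (lo x) (up x) (a x) (b x) :=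
  (ha.rat_add (hup.rat_mul ((hb.rat_sub ha).rat_max (.const 0)))).rat_sub
    (hlo.rat_mul ((ha.rat_sub hb).rat_max (.const 0)))

theorem computable_backward {lo up : ℕ → Situation → ℚ}
    (hD : Computable fun p : ℕ × ℕ × Situation => D p.1 p.2.1 p.2.2)
    (hlo : Computable fun p : ℕ × Situation => lo p.1 p.2)
    (hup : Computable fun p : ℕ × Situation => up p.1 p.2)
    {i k j : α → ℕ} {s : α → Situation} (hi : Computable i) (hk : Computable k)
    (hj : Computable j) (hs : Computable s) :
    Computable fun x => backward (lo (j x)) (up (j x)) (D (i x) (k x)) (k x) (s x) := by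
  have h₁ : Computable fun p : (ℕ × ℕ × ℕ) × Situation => (p.1.1, p.1.2.1, p.2) :=
    (Computable.fst.comp .fst).pair ((Computable.fst.comp (Computable.snd.comp .fst)).pair .snd)
  have h₂ := hD.comp h₁
  have hbase : Computable fun p : (ℕ × ℕ × ℕ) × Situation =>
      if D p.1.1 p.1.2.1 p.2 then (1 : ℚ) else 0 :=
    (Computable.cond h₂ (.const 1) (.const 0)).of_eq fun p => by
      cases h : D p.1.1 p.1.2.1 p.2 <;> simp
  have h₃ : Computable fun p : (ℕ × ℕ × ℕ) × Situation × ℚ × ℚ => (p.1.2.2, p.2.1) :=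
    (Computable.snd.comp (Computable.snd.comp .fst)).pair (Computable.fst.comp .snd)
  have h₄ := hlo.comp h₃
  have h₅ := hup.comp h₃
  have hstep := computable_branch h₄ h₅ (Computable.fst.comp (Computable.snd.comp .snd))
    (Computable.snd.comp (Computable.snd.comp .snd))
  have htree := Computable.treeRec (base := fun (p : ℕ × ℕ × ℕ) s => if D p.1 p.2.1 s then 1 else 0)
    (step := fun p s a b => branch (lo p.2.2 s) (up p.2.2 s) a b) hbase hstep
  have hlen : Computable fun x => k x - (s x).length :=
    Primrec.nat_sub.to_comp.comp hk (Computable.list_length.comp hs)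
  have h₆ := htree.comp ((hi.pair (hk.pair hj)).pair (hlen.pair hs))
  exact h₆

theorem computablePred_isAccepted
    (hD : Computable fun p : ℕ × ℕ × Situation => D p.1 p.2.1 p.2.2)
    {i j k : α → ℕ} (hi : Computable i) (hj : Computable j) (hk : Computable k) :
    ComputablePred fun x => IsAccepted D L U (i x) (j x) (k x) :=
  ComputablePred.rat_lt
    (computable_backward hD L.computable_below U.computable_above hi hk hj (.const []))
    (Computable.rat_pow (1 / 2) (Computable.succ.comp hi))

theorem computable_lastStage
    (hD : Computable fun p : ℕ × ℕ × Situation => D p.1 p.2.1 p.2.2)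
    {i j : α → ℕ} (hi : Computable i) (hj : Computable j) :
    Computable fun x => lastStage D L U (i x) (j x) := by
  have h₁ : Computable fun p : α × ℕ × ℕ => p.2.1 + 1 :=
    Computable.succ.comp (Computable.fst.comp .snd)
  have h₂ := (Computable.ite_pred
    (computablePred_isAccepted (L := L) (U := U) hD (hi.comp .fst) (hj.comp .fst) h₁)
    h₁ (Computable.snd.comp .snd)).to₂
  refine (Computable.nat_rec hj (.const 0) h₂).of_eq fun x => ?_
  have h (P : ℕ → Prop) [DecidablePred P] (n : ℕ) :
      Nat.rec (motive := fun _ => ℕ) 0 (fun y r => if P (y + 1) then y + 1 else r) n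
        = Nat.findGreatest P n := by
    induction n with
    | zero => rfl
    | succ n ih => rw [Nat.findGreatest_succ, ← ih]
  exact h (IsAccepted D L U (i x) (j x)) (j x)

theorem computable_summandApprox
    (hD : Computable fun p : ℕ × ℕ × Situation => D p.1 p.2.1 p.2.2)
    {i j : α → ℕ} {s : α → Situation} (hi : Computable i) (hj : Computable j)
    (hs : Computable s) : Computable fun x => summandApprox D L U (i x) (j x) (s x) :=
  computable_backward hD L.computable_above U.computable_below hi
    (computable_lastStage hD hi hj) hj hs

theorem computable_universalApprox
    (hD : Computable fun p : ℕ × ℕ × Situation => D p.1 p.2.1 p.2.2) :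
    Computable fun p : Situation × ℕ => universalApprox D L U p.1 p.2 := by
  have h₁ : Computable fun q : (Situation × ℕ) × ℕ × ℚ =>
      q.2.2 + summandApprox D L U q.2.1 q.1.2 q.1.1 :=
    (Computable.snd.comp .snd).rat_add (computable_summandApprox hD (Computable.fst.comp .snd)
      (Computable.snd.comp .fst) (Computable.fst.comp .fst))
  have h₂ : Computable fun p : Situation × ℕ =>
      ∑ i ∈ Finset.range p.2, summandApprox D L U i p.2 p.1 :=
    (Computable.nat_rec Computable.snd (.const 0) h₁.to₂).of_eq fun p => by
      have h (f : ℕ → ℚ) (n : ℕ) :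
          Nat.rec (motive := fun _ => ℚ) 0 (fun y r => r + f y) n = ∑ i ∈ Finset.range n, f i := by
        induction n with
        | zero => rfl
        | succ n ih => rw [Finset.sum_range_succ, ← ih]
      exact h (fun i => summandApprox D L U i p.2 p.1) p.2
  have h₃ : PrimrecPred fun s : Situation => s = [] := Primrec.eq.comp .id (.const [])
  have h₄ := h₃.computablePred_comp (Computable.fst (α := Situation) (β := ℕ))
  exact Computable.ite_pred h₄ (.const 1) h₂

end computability

/-! ### The enumeration of all recursively enumerable sets of situations -/

open Nat.Partrec (Code)

/-- The `k`-th stage of the enumeration of the situations that extend a situation `t` for which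
`(i + 2, t)` is accepted by the program with index `i.unpair.1`. -/
def stage (i k : ℕ) (s : Situation) : Bool :=
  (List.range (k + 1)).any fun m => (Code.evaln k (Denumerable.ofNat Code i.unpair.1)
    (Encodable.encode (i + 2, s.take m))).isSome

theorem stage_iff {i k : ℕ} {s : Situation} : stage i k s ↔ ∃ m ≤ k,
    (Code.evaln k (Denumerable.ofNat Code i.unpair.1)
      (Encodable.encode (i + 2, s.take m))).isSome := by
  simp only [stage, List.any_eq_true, List.mem_range, Nat.lt_succ_iff]

/-- Only prefixes of length at most `k` are tested, so later outcomes have no influence on the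
`k`-th stage. -/
theorem isStaged_stage : IsStaged stage where
  decided i k := by
    refine ⟨fun s x h => ?_, fun s x h => ?_⟩
    · obtain ⟨m, hm, h⟩ := stage_iff.1 h
      rcases le_total m s.length with hms | hms
      · exact stage_iff.2 ⟨m, hm, by rwa [List.take_append_of_le_length hms]⟩
      -- Here the accepted prefix is `s` itself, which must be cut off at its own length to exclude
      -- the new outcome.
      · refine stage_iff.2 ⟨s.length, hms.trans hm, ?_⟩
        rw [List.take_of_length_le hms] at h
        simpa using h
    · rw [Bool.eq_iff_iff, stage_iff, stage_iff]
      refine exists_congr fun m => and_congr_right fun hm => ?_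
      rw [List.take_append_of_le_length (hm.trans h)]
  mono i s k k' hk h := by
    obtain ⟨m, hm, h⟩ := stage_iff.1 h
    obtain ⟨y, hy⟩ := Option.isSome_iff_exists.1 h
    exact stage_iff.2 ⟨m, hm.trans hk, Option.isSome_iff_exists.2 ⟨y, Code.evaln_mono hk hy⟩⟩
  zero i s := by
    rw [Bool.eq_false_iff, Ne, stage_iff]
    simp [Code.evaln]

theorem computable_stage : Computable fun p : ℕ × ℕ × Situation => stage p.1 p.2.1 p.2.2 := by
  have h₁ : Primrec fun q : ℕ × ℕ × ℕ × Situation =>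
      Denumerable.ofNat Code q.2.1.unpair.1 :=
    (Primrec.ofNat Code).comp (Primrec.fst.comp (Primrec.unpair.comp
      (Primrec.fst.comp .snd)))
  have h₂ : Primrec fun q : ℕ × ℕ × ℕ × Situation => Encodable.encode (q.2.1 + 2, q.2.2.2.take q.1) :=
    Primrec.encode.comp (Primrec.pair
      (Primrec.nat_add.comp (Primrec.fst.comp .snd) (.const 2))
      (Primrec.list_take.comp .fst (Primrec.snd.comp (Primrec.snd.comp .snd))))
  have h₃ : Primrec fun q : ℕ × ℕ × ℕ × Situation => q.2.2.1 :=
    Primrec.fst.comp (Primrec.snd.comp .snd)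
  have h₄ := Primrec.option_isSome.comp (Code.primrec_evaln.comp (Primrec.pair (Primrec.pair h₃ h₁) h₂))
  have h₅ : PrimrecRel fun (m : ℕ) (p : ℕ × ℕ × Situation) =>
      (Code.evaln p.2.1 (Denumerable.ofNat Code p.1.unpair.1)
        (Encodable.encode (p.1 + 2, p.2.2.take m))).isSome = true :=
    Primrec.eq.comp h₄ (.const true)
  have h₆ := h₅.exists_mem_list.comp
    (Primrec.list_range.comp (Primrec.succ.comp (Primrec.fst.comp .snd))) Primrec.id
  classical
  refine h₆.computablePred.decide.of_eq fun p => ?_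
  rw [Bool.eq_iff_iff, decide_eq_true_iff]
  exact List.any_eq_true.symm

theorem exists_code_of_rePred {A : Set (ℕ × Situation)} (hA : REPred fun a => a ∈ A) :
    ∃ c : Code, ∀ a, a ∈ A ↔ ∃ k, (c.evaln k (Encodable.encode a)).isSome := by
  obtain ⟨c, hc⟩ := Code.exists_code.1 hA
  refine ⟨c, fun a => ?_⟩
  have h : (∃ y, y ∈ c.eval (Encodable.encode a)) ↔ a ∈ A := by
    rw [hc]
    simp
  rw [← h]
  simp only [Code.evaln_complete, Option.isSome_iff_exists]
  exact exists_comm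

theorem exists_stage_iff {A : Set (ℕ × Situation)} {c : Code}
    (hc : ∀ a, a ∈ A ↔ ∃ k, (c.evaln k (Encodable.encode a)).isSome) (m : ℕ) (s : Situation) :
    (∃ k, stage (Nat.pair (Encodable.encode c) m) k s)
      ↔ ∃ t, t <+: s ∧ (Nat.pair (Encodable.encode c) m + 2, t) ∈ A := by
  simp only [stage_iff, Nat.unpair_pair, Denumerable.ofNat_encode]
  constructor
  · rintro ⟨k, n, -, h⟩
    exact ⟨_, List.take_prefix n s, (hc _).2 ⟨k, h⟩⟩
  · rintro ⟨t, ht, h⟩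
    obtain ⟨k, hk⟩ := (hc _).1 h
    obtain ⟨y, hy⟩ := Option.isSome_iff_exists.1 hk
    -- The stage bounds both the running time and the length of the accepted prefix.
    refine ⟨max k t.length, t.length, le_max_right _ _, ?_⟩
    rw [← List.prefix_iff_eq_take.1 ht]
    exact Option.isSome_iff_exists.2 ⟨y, Code.evaln_mono (le_max_left _ _) hy⟩

end ImpreciseRandomness

/-! ### The cycle of implications -/

theorem mainTheorem5 (φ : ForecastingSystem) (hnd : φ.NonDegenerate) (hc : φ.IsComputable) :
    ∃ T : Situation → ℝ, IsTestSupermartingale φ T ∧ LowerSemicomputable T ∧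
      ∀ ω : OutcomePath,
        (¬ IsMartinLofRandom φ ω ↔ Tendsto (fun n => T (ω.upTo n)) atTop atTop) ∧
        (¬ IsMartinLofTestRandom φ ω ↔ Tendsto (fun n => T (ω.upTo n)) atTop atTop) := by
  obtain ⟨L⟩ := hc.1.nonempty_unitApproximation φ.lower_mem
  obtain ⟨U⟩ := hc.2.nonempty_unitApproximation φ.upper_mem
  obtain ⟨C, hC₀, hC⟩ := hnd.exists_growth_bound
  have hT := isTestSupermartingale_universal L U isStaged_stage hC₀ hC hnd
  have hlsc : LowerSemicomputable (universal stage L U) :=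
    ⟨fun p => universalApprox stage L U p.1 p.2,
      Computable.rat_iff.1 (computable_universalApprox computable_stage),
      fun s j => universalApprox_le_succ L U isStaged_stage j s,
      fun s => tendsto_universalApprox L U isStaged_stage s hC₀ hC⟩
  refine ⟨universal stage L U, hT, hlsc, fun ω => ?_⟩
  have h₁ : Tendsto (fun n => universal stage L U (ω.upTo n)) atTop atTop →
      ¬ IsMartinLofRandom φ ω := fun h hω => by
    obtain ⟨B, hB⟩ := hω _ hT hlsc
    obtain ⟨n, hn⟩ := (h.eventually_gt_atTop B).exists
    exact (hB n).not_gt hn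
  have h₂ : ¬ IsMartinLofRandom φ ω → ¬ IsMartinLofTestRandom φ ω :=
    mt IsMartinLofTestRandom.isMartinLofRandom
  have h₃ : ¬ IsMartinLofTestRandom φ ω →
      Tendsto (fun n => universal stage L U (ω.upTo n)) atTop atTop := by
    intro h
    simp only [IsMartinLofTestRandom, not_forall, not_not] at h
    obtain ⟨G, ⟨A, hA, hG⟩, hω⟩ := h
    obtain ⟨c, hcode⟩ := exists_code_of_rePred hA
    -- All the indices `Nat.pair (encode c) m` run the same program `c`, each on a different level
    -- of the test.
    refine tendsto_universal_atTop L U isStaged_stage hC₀ hC hnd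
      (f := fun m => Nat.pair (Encodable.encode c) m) (fun m m' h => (Nat.pair_eq_pair.1 h).2)
      fun m => ?_
    set i := Nat.pair (Encodable.encode c) m
    -- Level `i + 2` instead of `i + 1` makes the bound needed for acceptance strict.
    obtain ⟨hGi, hP⟩ := hG (i + 2)
    have hsub (k : ℕ) : cylinderUnion {s | stage i k s} ⊆ G (i + 2) := by
      intro ω' hω'
      obtain ⟨n, hn⟩ := mem_cylinderUnion.1 hω'
      obtain ⟨t, ht, htA⟩ := (exists_stage_iff hcode m _).1 ⟨k, hn⟩
      rw [hGi]
      refine mem_cylinderUnion.2 ⟨t.length, ?_⟩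
      have hlen := ht.length_le
      rw [OutcomePath.length_upTo] at hlen
      rw [← OutcomePath.take_upTo ω' hlen, ← List.prefix_iff_eq_take.1 ht]
      exact htA
    have hlt (k : ℕ) : upperProb φ (cylinderUnion {s | stage i k s}) < (1 / 2) ^ (i + 1) :=
      ((upperProb_mono (hsub k)).trans hP).trans_lt
        (pow_lt_pow_right_of_lt_one₀ (by norm_num) (by norm_num) (by omega))
    have hmem := mem_iInter.1 hω (i + 2)
    rw [hGi] at hmem
    obtain ⟨n₀, hn₀⟩ := mem_cylinderUnion.1 hmem
    filter_upwards [eventually_ge_atTop n₀] with n hn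
    obtain ⟨k, hk⟩ := (exists_stage_iff hcode m _).2 ⟨_, OutcomePath.upTo_prefix ω hn, hn₀⟩
    exact one_le_summand L U isStaged_stage i k _ hC₀ hC (hlt k) hk
  exact ⟨⟨fun h => h₃ (h₂ h), h₁⟩, ⟨h₃, fun h => h₂ (h₁ h)⟩⟩
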